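/- **Globular sums.** Let $\mathbb{G}$ be the globular category: its objects are the disks $D_i$, $i\ge 0$, and it is generated by $\sigma_i,\tau_i : D_{i-1}\to D_i$, $i \ge 1$, subject to $\sigma_{i+1}\sigma_i=\tau_{i+1}\sigma_i$ and $\sigma_{i+1}\tau_i=\tau_{i+1}\tau_i$. Write $\sigma^j_i,\tau^j_i : D_j\to D_i$ for the iterated composites. A globular set is a presheaf of sets on $\mathbb{G}$. A table of dimensions is a finite sequence of non-negative integers $i_1,\dots,i_n,i'_1,\dots,i'_{n-1}$ ($n\ge 1$) with $i_k>i'_k<i_{k+1}$ for $1\le k\le n-1$. Its globular sum in a category $C$ under $\mathbb{G}$ is, if it exists, the colimit $D_{i_1}\amalg_{D_{i'_1}}\cdots\amalg_{D_{i'_{n-1}}}D_{i_n}$ of the zig-zag with maps $\sigma^{i'_k}_{i_k} : D_{i'_k}\to D_{i_k}$ and $\tau^{i'_k}_{i_{k+1}} : D_{i'_k}\to D_{i_{k+1}}$. A globular extension is a category under $\mathbb{G}$ in which all globular sums exist. A globular presheaf on it is a presheaf of sets sending globular sums to limits; these form the full subcategory $\mathrm{Mod}(C)$ of the category of presheaves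 on $C$. **The category $\Theta_0$.** Let $\Theta_0$ be the category whose objects are the tables of dimensions and whose morphisms are the morphisms of globular sets between the associated globular sums of representable globular sets. It is a globular extension. A globular pasting scheme is a globular set isomorphic to the restriction to $\mathbb{G}$ of a presheaf on $\Theta_0$ represented by an object of $\Theta_0$. A globular extension under $\Theta_0$ is a category $C$ with a functor $\Theta_0\to C$ that respects globular sums, $C$ being a globular extension via $\mathbb{G}\to\Theta_0\to C$. **Categorical globular extensions.** A categorical globular extension is a globular extension $C$ under $\Theta_0$ with morphisms $\nabla^j_i : D_i\to D_i\amalg_{D_j}D_i$ ($i>j\ge 0$) and $\kappa_i : D_{i+1}\to D_i$ ($i\ge 0$) satisfying the duals of the source and target conditions for compositions and units and of the associativity, exchange, left and right unit and functoriality-of-units axioms of strict $\infty$-categories. For a category $C$, let $\mathrm{ExtCat}(C)$ be the category of categorical globular extension structures on $C$; its morphisms are the natural transformations of functors $\Theta_0\to C$ that are compatible with the $\nabla^j_i$ and the $\kappa_i$. **Universal property.** A categorical globular extension $\Theta$, with $\Theta$ a small category, is called universal if, for every locally small category $C$, sending a functor $H : \Theta\to C$ to its composite with $\Theta_0\to\Theta$,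 equipped with the images under $H$ of the $\nabla^j_i$ and $\kappa_i$ of $\Theta$, is an isomorphism of categories from the category of functors $\Theta\to C$ whose composite with $\Theta_0\to\Theta$ makes $C$ a globular extension under $\Theta_0$ (with all natural transformations) onto $\mathrm{ExtCat}(C)$. **Statement.** A universal categorical globular extension exists. Let $\Theta$ be any universal categorical globular extension and let $$F : \Theta\to\mathrm{Mod}(\Theta)\to\infty\text{-}\mathrm{Cat}$$ be the composite of the Yoneda functor and of the functor sending a globular presheaf $X$ on $\Theta$ to its restriction to $\mathbb{G}$ with compositions $X(\nabla^j_i)$ and units $X(\kappa_i)$, where $\infty\text{-}\mathrm{Cat}$ is the category of (small) strict $\infty$-categories. Then $F$ is fully faithful; a strict $\infty$-category belongs to its essential image if and only if it is a free strict $\infty$-category on some globular pasting scheme; and every globular pasting scheme admits a free strict $\infty$-category on it. Hence $F$ identifies $\Theta$, up to equivalence, with the full subcategory of $\infty\text{-}\mathrm{Cat}$ whose objects are the free strict $\infty$-categories on globular pasting schemes. Here a strict $\infty$-category $X$ is free on a globular set $P$ if there is a morphism $P\to UX$ that is universal from $P$ to the forgetful functor $U$ from strict $\infty$-categories to globular sets.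 -/

import Mathlib

open CategoryTheory Limits Opposite

universe u v w w'

namespace Globular

/-! ## The globular category -/

/-- Objects of the globular category: the disks `D i`, one for each `i : ℕ`. -/
structure Globe : Type u where
  /-- the dimension of the disk -/
  dim : ℕ

namespace Globe

/-- Morphisms of the globular category.  The coglobular relations say that a composite of cosources
and cotargets only depends on its domain, its codomain and its first factor, so besides the
identities there are exactly two morphisms `D j ⟶ D i` for `j < i`:
the iterated cosource `src` and the iterated cotarget `tgt`. -/
inductive Hom : Globe.{u} → Globe.{u} → Type u
  | id (a : Globe.{u}) : Hom a a
  | src {a b : Globe.{u}} (h : a.dim < b.dim) : Hom a b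
  | tgt {a b : Globe.{u}} (h : a.dim < b.dim) : Hom a b

/-- Composition in the globular category (in diagrammatic order). -/
def Hom.comp : ∀ {a b c : Globe.{u}}, Hom a b → Hom b c → Hom a c
  | _, _, _, .id _, g => g
  | _, _, _, .src h, .id _ => .src h
  | _, _, _, .src h, .src h' => .src (h.trans h')
  | _, _, _, .src h, .tgt h' => .src (h.trans h')
  | _, _, _, .tgt h, .id _ => .tgt h
  | _, _, _, .tgt h, .src h' => .tgt (h.trans h')
  | _, _, _, .tgt h, .tgt h' => .tgt (h.trans h')

/-- The globular category. -/
instance : Category.{u} Globe.{u} where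
  Hom := Hom
  id := Hom.id
  comp := Hom.comp
  id_comp _ := rfl
  comp_id f := by cases f <;> rfl
  assoc f g h := by cases f <;> cases g <;> cases h <;> rfl

end Globe

/-- The disk of dimension `i`. -/
abbrev D (i : ℕ) : Globe.{u} := ⟨i⟩

/-- The iterated cosource `D j ⟶ D i`, for `j < i`. -/
def sigma {i j : ℕ} (h : j < i) : D.{u} j ⟶ D i := Globe.Hom.src h

/-- The iterated cotarget `D j ⟶ D i`, for `j < i`. -/
def tau {i j : ℕ} (h : j < i) : D.{u} j ⟶ D i := Globe.Hom.tgt h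

lemma sigma_sigma {i j k : ℕ} (h : j < i) (h' : k < j) :
    sigma.{u} h' ≫ sigma h = sigma (h'.trans h) := rfl

lemma sigma_tau {i j k : ℕ} (h : j < i) (h' : k < j) :
    sigma.{u} h' ≫ tau h = sigma (h'.trans h) := rfl

lemma tau_sigma {i j k : ℕ} (h : j < i) (h' : k < j) :
    tau.{u} h' ≫ sigma h = tau (h'.trans h) := rfl

lemma tau_tau {i j k : ℕ} (h : j < i) (h' : k < j) :
    tau.{u} h' ≫ tau h = tau (h'.trans h) := rfl

/-! ## Globular sums and globular extensions -/

/-- A table of dimensions of width `n + 1`. -/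
structure Table where
  /-- the width minus one -/
  n : ℕ
  /-- the upper row -/
  dim : Fin (n + 1) → ℕ
  /-- the lower row -/
  gap : Fin n → ℕ
  gap_lt_left (k : Fin n) : gap k < dim k.castSucc
  gap_lt_right (k : Fin n) : gap k < dim k.succ

namespace Table

/-- The zig-zag shape of the diagram associated to a table of dimensions: the `k`-th lower object
maps to the `k`-th and to the `(k+1)`-st upper object. -/
@[simps]
def shape (T : Table) : MultispanShape.{0, 0} where
  L := Fin T.n
  R := Fin (T.n + 1)
  fst := Fin.castSucc
  snd := Fin.succ

/-- The zig-zag diagram associated to a table of dimensions in a category under the globular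
category, whose colimit is the globular sum. -/
@[simps]
def index (T : Table) {C : Type w} [Category.{v} C] (F : Globe.{u} ⥤ C) :
    MultispanIndex T.shape C where
  left k := F.obj (D (T.gap k))
  right k := F.obj (D (T.dim k))
  fst k := F.map (sigma (T.gap_lt_left k))
  snd k := F.map (tau (T.gap_lt_right k))

/-- The table of width one `(i)`. -/
def single (i : ℕ) : Table where
  n := 0
  dim _ := i
  gap _ := 0
  gap_lt_left k := k.elim0
  gap_lt_right k := k.elim0

/-- The table of width two with upper row `i, i` and lower row `j`. -/
def pair {i j : ℕ} (h : j < i) : Table where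
  n := 1
  dim _ := i
  gap _ := j
  gap_lt_left _ := h
  gap_lt_right _ := h

/-- The table of width three with upper row `i, i, i` and lower row `j, j`. -/
def triple {i j : ℕ} (h : j < i) : Table where
  n := 2
  dim _ := i
  gap _ := j
  gap_lt_left _ := h
  gap_lt_right _ := h

/-- The table of width four with upper row `i, i, i, i` and lower row `j, k, j`. -/
def quad {i j k : ℕ} (h : j < i) (h' : k < j) : Table where
  n := 3
  dim _ := i
  gap := ![j, k, j]
  gap_lt_left := by
    intro a
    fin_cases a
    exacts [h, h'.trans h, h]
  gap_lt_right := by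
    intro a
    fin_cases a
    exacts [h, h'.trans h, h]

/-- The globular sum of the table `T` in the category of globular sets. -/
noncomputable def globularSet (T : Table) : Globe.{u}ᵒᵖ ⥤ Type u :=
  multicoequalizer (T.index (yoneda (C := Globe.{u})))

end Table

/-- `(C, F)` is a globular extension if all the globular sums exist in it. -/
def IsGlobularExtension {C : Type w} [Category.{v} C] (F : Globe.{u} ⥤ C) : Prop :=
  ∀ T : Table, HasMulticoequalizer (T.index F)

/-- The category `Θ₀`: its objects are the tables of dimensions, its morphisms are the morphisms
between the associated globular sums in globular sets. -/
abbrev Theta0 : Type := InducedCategory (Globe.{u}ᵒᵖ ⥤ Type u) Table.globularSet.{u}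

/-- The object of `Θ₀` associated to a table of dimensions. -/
abbrev Table.obj (T : Table) : Theta0.{u} := T

/-- The morphism of globular sets from the `k`-th disk to the globular sum. -/
noncomputable def Table.leg (T : Table) (k : Fin (T.n + 1)) :
    yoneda.obj (D.{u} (T.dim k)) ⟶ T.globularSet :=
  Multicoequalizer.π (T.index (yoneda (C := Globe.{u}))) k

lemma Table.leg_condition (T : Table) (k : Fin T.n) :
    yoneda.map (sigma.{u} (T.gap_lt_left k)) ≫ T.leg k.castSucc =
      yoneda.map (tau (T.gap_lt_right k)) ≫ T.leg k.succ :=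
  Multicoequalizer.condition (T.index (yoneda (C := Globe.{u}))) k

/-- The canonical isomorphism from the disk to the globular sum of a table of width one. -/
noncomputable def Table.legSingle (i : ℕ) :
    yoneda.obj (D.{u} i) ⟶ (Table.single i).globularSet :=
  (Table.single i).leg (0 : Fin 1)

/-- Morphisms out of the globular sum of a table of width one. -/
noncomputable def Table.descSingle (i : ℕ) {X : Globe.{u}ᵒᵖ ⥤ Type u}
    (f : yoneda.obj (D.{u} i) ⟶ X) : (Table.single i).globularSet ⟶ X :=
  Multicoequalizer.desc ((Table.single i).index (yoneda (C := Globe.{u}))) X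
    (fun _ => f) (fun k => k.elim0)

@[simp]
lemma Table.legSingle_descSingle (i : ℕ) {X : Globe.{u}ᵒᵖ ⥤ Type u}
    (f : yoneda.obj (D.{u} i) ⟶ X) :
    Table.legSingle i ≫ Table.descSingle i f = f :=
  Multicoequalizer.π_desc _ _ _ _ _

lemma Table.legSingle_descSingle_assoc (i : ℕ) {X Z : Globe.{u}ᵒᵖ ⥤ Type u}
    (f : yoneda.obj (D.{u} i) ⟶ X) (g : X ⟶ Z) :
    Table.legSingle i ≫ Table.descSingle i f ≫ g = f ≫ g := by
  rw [← Category.assoc, Table.legSingle_descSingle]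

lemma Table.single_hom_ext {i : ℕ} {X : Globe.{u}ᵒᵖ ⥤ Type u}
    {f g : (Table.single i).globularSet ⟶ X}
    (h : Table.legSingle i ≫ f = Table.legSingle i ≫ g) : f = g :=
  Multicoequalizer.hom_ext _ _ _ (fun k => by
    obtain rfl : k = (0 : Fin 1) := Subsingleton.elim (α := Fin 1) _ _
    exact h)

/-- The canonical functor from the globular category to `Θ₀`, sending the disk `D i` to the table
of width one `(i)`. -/
noncomputable def globeToTheta0 : Globe.{u} ⥤ Theta0.{u} where
  obj a := (Table.single a.dim).obj
  map {a b} f := InducedCategory.homMk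
    (Table.descSingle a.dim (yoneda.map f ≫ Table.legSingle b.dim))
  map_id a := by
    ext1
    refine Table.single_hom_ext ?_
    erw [Table.legSingle_descSingle, yoneda.map_id, Category.id_comp]
  map_comp f g := by
    ext1
    refine Table.single_hom_ext ?_
    erw [Table.legSingle_descSingle, Table.legSingle_descSingle_assoc, Category.assoc,
      Table.legSingle_descSingle, Functor.map_comp, Category.assoc]

/-- The canonical morphism from the `k`-th disk to the globular sum, in `Θ₀`. -/
noncomputable def Table.incl (T : Table) (k : Fin (T.n + 1)) :
    globeToTheta0.{u}.obj (D (T.dim k)) ⟶ T.obj :=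
  InducedCategory.homMk (Table.descSingle (T.dim k) (T.leg k))

lemma Table.incl_condition (T : Table) (k : Fin T.n) :
    globeToTheta0.{u}.map (sigma (T.gap_lt_left k)) ≫ T.incl k.castSucc =
      globeToTheta0.map (tau (T.gap_lt_right k)) ≫ T.incl k.succ := by
  ext1
  refine Table.single_hom_ext ?_
  simp only [globeToTheta0, Table.incl, InducedCategory.comp_hom, InducedCategory.homMk_hom]
  erw [Table.legSingle_descSingle_assoc, Table.legSingle_descSingle_assoc, Category.assoc,
    Category.assoc, Table.legSingle_descSingle, Table.legSingle_descSingle]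
  exact T.leg_condition k

section Sums

variable {C : Type w} [Category.{v} C] (G : Theta0.{u} ⥤ C)

/-- The `i`-th disk of a category under `Θ₀`. -/
noncomputable abbrev disk (i : ℕ) : C := G.obj (globeToTheta0.obj (D i))

/-- The iterated cosource of a category under `Θ₀`. -/
noncomputable abbrev src {i j : ℕ} (h : j < i) : disk G j ⟶ disk G i :=
  G.map (globeToTheta0.map (sigma h))

/-- The iterated cotarget of a category under `Θ₀`. -/
noncomputable abbrev tgt {i j : ℕ} (h : j < i) : disk G j ⟶ disk G i :=
  G.map (globeToTheta0.map (tau h))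

/-- The canonical morphism from the `k`-th disk to the image of a table of dimensions. -/
noncomputable abbrev eps (T : Table) (k : Fin (T.n + 1)) : disk G (T.dim k) ⟶ G.obj T.obj :=
  G.map (T.incl k)

/-- The image in `C` of the globular sum of the table `T`, as a cocone under the zig-zag
diagram associated to `T` in `C`. -/
noncomputable def sumCofork (T : Table) : Multicofork (T.index (globeToTheta0 ⋙ G)) :=
  Multicofork.ofπ _ (G.obj T.obj) (fun k => eps G T k) (fun k => by
    have h := congrArg G.map (T.incl_condition k)
    rw [G.map_comp, G.map_comp] at h
    exact h)

/-- `(C, G)` is a globular extension under `Θ₀`: all the globular sums exist in `C`, and the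
globular sum associated to a table of dimensions is the image of this table by `G`. -/
structure IsGlobularUnder : Prop where
  isGlobularExtension : IsGlobularExtension (globeToTheta0 ⋙ G)
  isSum (T : Table) : Nonempty (IsColimit (sumCofork G T))

namespace IsGlobularUnder

variable {G} (hG : IsGlobularUnder G)

/-- The morphism from a globular sum given by a compatible family of morphisms. -/
noncomputable def desc (T : Table) {X : C} (f : ∀ k : Fin (T.n + 1), disk G (T.dim k) ⟶ X)
    (hf : ∀ k : Fin T.n, src G (T.gap_lt_left k) ≫ f k.castSucc =
      tgt G (T.gap_lt_right k) ≫ f k.succ) : G.obj T.obj ⟶ X :=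
  Multicofork.IsColimit.desc (hG.isSum T).some f hf

lemma eps_desc (T : Table) {X : C} (f : ∀ k : Fin (T.n + 1), disk G (T.dim k) ⟶ X)
    (hf : ∀ k : Fin T.n, src G (T.gap_lt_left k) ≫ f k.castSucc =
      tgt G (T.gap_lt_right k) ≫ f k.succ) (k : Fin (T.n + 1)) :
    eps G T k ≫ hG.desc T f hf = f k :=
  Multicofork.IsColimit.fac (hG.isSum T).some f hf k

lemma hom_ext (hG : IsGlobularUnder G) (T : Table) {X : C} {f g : G.obj T.obj ⟶ X}
    (h : ∀ k, eps G T k ≫ f = eps G T k ≫ g) : f = g :=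
  Multicofork.IsColimit.hom_ext (hG.isSum T).some h

end IsGlobularUnder

lemma eps_condition (T : Table) (k : Fin T.n) :
    src G (T.gap_lt_left k) ≫ eps G T k.castSucc =
      tgt G (T.gap_lt_right k) ≫ eps G T k.succ := by
  rw [← G.map_comp, T.incl_condition, G.map_comp]

/-- The globular sum `D i ⨿_{D j} D i`. -/
noncomputable abbrev pairObj {i j : ℕ} (h : j < i) : C := G.obj (Table.pair h).obj

/-- The first canonical morphism `D i ⟶ D i ⨿_{D j} D i`. -/
noncomputable def eps₁ {i j : ℕ} (h : j < i) : disk G i ⟶ pairObj G h :=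
  eps G (Table.pair h) (0 : Fin 2)

/-- The second canonical morphism `D i ⟶ D i ⨿_{D j} D i`. -/
noncomputable def eps₂ {i j : ℕ} (h : j < i) : disk G i ⟶ pairObj G h :=
  eps G (Table.pair h) (1 : Fin 2)

lemma src_eps₁ {i j : ℕ} (h : j < i) : src G h ≫ eps₁ G h = tgt G h ≫ eps₂ G h :=
  eps_condition G (Table.pair h) (0 : Fin 1)

/-- The globular sum `D i ⨿_{D j} D i ⨿_{D j} D i`. -/
noncomputable abbrev tripleObj {i j : ℕ} (h : j < i) : C := G.obj (Table.triple h).obj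

/-- The canonical morphisms `D i ⟶ D i ⨿_{D j} D i ⨿_{D j} D i`. -/
noncomputable def epsTriple {i j : ℕ} (h : j < i) (a : Fin 3) : disk G i ⟶ tripleObj G h :=
  eps G (Table.triple h) a

lemma src_epsTriple₀ {i j : ℕ} (h : j < i) :
    src G h ≫ epsTriple G h 0 = tgt G h ≫ epsTriple G h 1 :=
  eps_condition G (Table.triple h) (0 : Fin 2)

lemma src_epsTriple₁ {i j : ℕ} (h : j < i) :
    src G h ≫ epsTriple G h 1 = tgt G h ≫ epsTriple G h 2 :=
  eps_condition G (Table.triple h) (1 : Fin 2)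

/-- The globular sum `D i ⨿_{D j} D i ⨿_{D k} D i ⨿_{D j} D i`. -/
noncomputable abbrev quadObj {i j k : ℕ} (h : j < i) (h' : k < j) : C :=
  G.obj (Table.quad h h').obj

/-- The canonical morphisms `D i ⟶ D i ⨿_{D j} D i ⨿_{D k} D i ⨿_{D j} D i`. -/
noncomputable def epsQuad {i j k : ℕ} (h : j < i) (h' : k < j) (a : Fin 4) :
    disk G i ⟶ quadObj G h h' :=
  eps G (Table.quad h h') a

lemma src_epsQuad₀ {i j k : ℕ} (h : j < i) (h' : k < j) :
    src G h ≫ epsQuad G h h' 0 = tgt G h ≫ epsQuad G h h' 1 :=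
  eps_condition G (Table.quad h h') (0 : Fin 3)

lemma src_epsQuad₁ {i j k : ℕ} (h : j < i) (h' : k < j) :
    src G (h'.trans h) ≫ epsQuad G h h' 1 = tgt G (h'.trans h) ≫ epsQuad G h h' 2 :=
  eps_condition G (Table.quad h h') (1 : Fin 3)

lemma src_epsQuad₂ {i j k : ℕ} (h : j < i) (h' : k < j) :
    src G h ≫ epsQuad G h h' 2 = tgt G h ≫ epsQuad G h h' 3 :=
  eps_condition G (Table.quad h h') (2 : Fin 3)

section

variable {i j k : ℕ} (h : j < i) (h' : k < j)

lemma src_src : src G h' ≫ src G h = src G (h'.trans h) := by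
  simp only [← Functor.map_comp]; rfl

lemma src_src_assoc {Z : C} (f : disk G i ⟶ Z) :
    src G h' ≫ src G h ≫ f = src G (h'.trans h) ≫ f := by
  rw [← Category.assoc, src_src]

lemma src_tgt : src G h' ≫ tgt G h = src G (h'.trans h) := by
  simp only [← Functor.map_comp]; rfl

lemma src_tgt_assoc {Z : C} (f : disk G i ⟶ Z) :
    src G h' ≫ tgt G h ≫ f = src G (h'.trans h) ≫ f := by
  rw [← Category.assoc, src_tgt]

lemma tgt_src : tgt G h' ≫ src G h = tgt G (h'.trans h) := by
  simp only [← Functor.map_comp]; rfl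

lemma tgt_src_assoc {Z : C} (f : disk G i ⟶ Z) :
    tgt G h' ≫ src G h ≫ f = tgt G (h'.trans h) ≫ f := by
  rw [← Category.assoc, tgt_src]

lemma tgt_tgt : tgt G h' ≫ tgt G h = tgt G (h'.trans h) := by
  simp only [← Functor.map_comp]; rfl

lemma tgt_tgt_assoc {Z : C} (f : disk G i ⟶ Z) :
    tgt G h' ≫ tgt G h ≫ f = tgt G (h'.trans h) ≫ f := by
  rw [← Category.assoc, tgt_tgt]

end

namespace IsGlobularUnder

variable {G} (hG : IsGlobularUnder G) {i j : ℕ} (h : j < i) {X : C}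

/-- The morphism `(a, b) : D i ⨿_{D j} D i ⟶ X`. -/
noncomputable def copair (a b : disk G i ⟶ X) (e : src G h ≫ a = tgt G h ≫ b) :
    pairObj G h ⟶ X :=
  hG.desc (Table.pair h) (fun (k : Fin 2) => match k with
    | 0 => a
    | 1 => b) (fun (k : Fin 1) => match k with
    | 0 => e)

@[simp]
lemma eps₁_copair (a b : disk G i ⟶ X) (e : src G h ≫ a = tgt G h ≫ b) :
    eps₁ G h ≫ hG.copair h a b e = a :=
  hG.eps_desc (Table.pair h) _ _ (0 : Fin 2)

@[simp]
lemma eps₁_copair_assoc (a b : disk G i ⟶ X) (e : src G h ≫ a = tgt G h ≫ b) {Y : C}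
    (f : X ⟶ Y) : eps₁ G h ≫ hG.copair h a b e ≫ f = a ≫ f := by
  rw [← Category.assoc, eps₁_copair]

@[simp]
lemma eps₂_copair (a b : disk G i ⟶ X) (e : src G h ≫ a = tgt G h ≫ b) :
    eps₂ G h ≫ hG.copair h a b e = b :=
  hG.eps_desc (Table.pair h) _ _ (1 : Fin 2)

@[simp]
lemma eps₂_copair_assoc (a b : disk G i ⟶ X) (e : src G h ≫ a = tgt G h ≫ b) {Y : C}
    (f : X ⟶ Y) : eps₂ G h ≫ hG.copair h a b e ≫ f = b ≫ f := by
  rw [← Category.assoc, eps₂_copair]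

lemma pair_ext (hG : IsGlobularUnder G) {i j : ℕ} (h : j < i) {f g : pairObj G h ⟶ X} (h₁ : eps₁ G h ≫ f = eps₁ G h ≫ g)
    (h₂ : eps₂ G h ≫ f = eps₂ G h ≫ g) : f = g :=
  hG.hom_ext (Table.pair h) (fun (k : Fin 2) => match k with
    | 0 => h₁
    | 1 => h₂)

lemma copair_comp (a b : disk G i ⟶ X) (e : src G h ≫ a = tgt G h ≫ b) {Y : C} (f : X ⟶ Y) :
    hG.copair h a b e ≫ f = hG.copair h (a ≫ f) (b ≫ f)
      (by rw [← Category.assoc, e, Category.assoc]) := by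
  apply hG.pair_ext h <;> simp

end IsGlobularUnder

end Sums

lemma legSingle_globeToTheta0 {a b : Globe.{u}} (f : a ⟶ b) :
    Table.legSingle a.dim ≫ (globeToTheta0.map f).hom = yoneda.map f ≫ Table.legSingle b.dim :=
  Table.legSingle_descSingle _ _

lemma legSingle_incl (T : Table) (k : Fin (T.n + 1)) :
    Table.legSingle (T.dim k) ≫ (T.incl.{u} k).hom = T.leg k :=
  Table.legSingle_descSingle _ _

/-- `Θ₀` is a globular extension, in which the globular sum associated to a table of dimensions is
this table. -/
lemma isGlobularUnder_id : IsGlobularUnder (𝟭 Theta0.{u}) := by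
  have key : ∀ T : Table, Nonempty (IsColimit (sumCofork (𝟭 Theta0.{u}) T)) := by
    intro T
    refine ⟨Multicofork.IsColimit.mk _
      (fun E => InducedCategory.homMk (Multicoequalizer.desc (T.index (yoneda (C := Globe.{u}))) _
        (fun k => Table.legSingle (T.dim k) ≫ (E.π k).hom) (fun k => ?_))) ?_ ?_⟩
    · have h := congrArg InducedCategory.Hom.hom (E.condition k)
      have h' := congrArg (fun f => Table.legSingle (T.gap k) ≫ f) h
      have h₁ := congrArg (fun f => f ≫ (E.π k.castSucc).hom)
        (legSingle_globeToTheta0 (sigma.{u} (T.gap_lt_left k)))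
      have h₂ := congrArg (fun f => f ≫ (E.π k.succ).hom)
        (legSingle_globeToTheta0 (tau.{u} (T.gap_lt_right k)))
      exact h₁.symm.trans (h'.trans h₂)
    · intro E k
      apply InducedCategory.hom_ext
      refine Table.single_hom_ext ?_
      refine (congrArg (fun f => f ≫ _) (legSingle_incl T k)).trans ?_
      exact Multicoequalizer.π_desc _ _ _ _ _
    · intro E m hm
      apply InducedCategory.hom_ext
      refine Multicoequalizer.hom_ext _ _ _ (fun k => ?_)
      refine Eq.trans ?_ (Multicoequalizer.π_desc _ _ _ _ _).symm
      rw [← hm k]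
      exact (congrArg (fun f => f ≫ m.hom) (legSingle_incl T k)).symm
  exact ⟨fun T => HasColimit.mk ⟨_, (key T).some⟩, key⟩

/-! ## Categorical globular extensions -/

/-- The structure of a precategorical globular extension on a category `C`. -/
structure PrecatStructure (C : Type w) [Category.{v} C] where
  functor : Theta0.{u} ⥤ C
  isGlobular : IsGlobularUnder functor
  nabla {i j : ℕ} (h : j < i) : disk functor i ⟶ pairObj functor h
  kappa (i : ℕ) : disk functor (i + 1) ⟶ disk functor i
  src_nabla_top (i : ℕ) :
    src functor i.lt_succ_self ≫ nabla i.lt_succ_self =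
      src functor i.lt_succ_self ≫ eps₂ functor i.lt_succ_self
  src_nabla_low {i j : ℕ} (h : j < i) :
    src functor i.lt_succ_self ≫ nabla (h.trans i.lt_succ_self) =
      nabla h ≫ isGlobular.copair h
        (src functor i.lt_succ_self ≫ eps₁ functor (h.trans i.lt_succ_self))
        (src functor i.lt_succ_self ≫ eps₂ functor (h.trans i.lt_succ_self))
        (by rw [src_src_assoc, tgt_src_assoc, src_eps₁])
  tgt_nabla_top (i : ℕ) :
    tgt functor i.lt_succ_self ≫ nabla i.lt_succ_self =
      tgt functor i.lt_succ_self ≫ eps₁ functor i.lt_succ_self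
  tgt_nabla_low {i j : ℕ} (h : j < i) :
    tgt functor i.lt_succ_self ≫ nabla (h.trans i.lt_succ_self) =
      nabla h ≫ isGlobular.copair h
        (tgt functor i.lt_succ_self ≫ eps₁ functor (h.trans i.lt_succ_self))
        (tgt functor i.lt_succ_self ≫ eps₂ functor (h.trans i.lt_succ_self))
        (by rw [src_tgt_assoc, tgt_tgt_assoc, src_eps₁])
  src_kappa (i : ℕ) : src functor i.lt_succ_self ≫ kappa i = 𝟙 _
  tgt_kappa (i : ℕ) : tgt functor i.lt_succ_self ≫ kappa i = 𝟙 _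

namespace PrecatStructure

variable {C : Type w} [Category.{v} C] (S : PrecatStructure.{u} C)

/-- The morphism `(a, b) : D i ⨿_{D j} D i ⟶ X`. -/
noncomputable abbrev copair {i j : ℕ} (h : j < i) {X : C} (a b : disk S.functor i ⟶ X)
    (e : src S.functor h ≫ a = tgt S.functor h ≫ b) : pairObj S.functor h ⟶ X :=
  S.isGlobular.copair h a b e

/-- The iterated morphism `D i ⟶ D j`, for `j ≤ i`. -/
noncomputable def kappaIter {i j : ℕ} (h : j ≤ i) : disk S.functor i ⟶ disk S.functor j :=
  Nat.leRec (motive := fun i _ => disk S.functor i ⟶ disk S.functor j) (𝟙 _)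
    (fun i _ f => S.kappa i ≫ f) h

lemma kappaIter_self (j : ℕ) : S.kappaIter (le_refl j) = 𝟙 _ :=
  Nat.leRec_self _ _

lemma kappaIter_succ {i j : ℕ} (h : j ≤ i) :
    S.kappaIter (h.trans i.le_succ) = S.kappa i ≫ S.kappaIter h :=
  Nat.leRec_succ _ _ _

section

variable {i j : ℕ} (h : j < i)

lemma src_kappaIter : src S.functor h ≫ S.kappaIter h.le = 𝟙 _ := by
  induction i with
  | zero => exact absurd h (Nat.not_lt_zero j)
  | succ i ih =>
    rcases Nat.lt_succ_iff_lt_or_eq.1 h with h' | rfl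
    · rw [S.kappaIter_succ h'.le, ← src_src S.functor i.lt_succ_self h', Category.assoc,
        ← Category.assoc (src S.functor i.lt_succ_self), S.src_kappa, Category.id_comp, ih h']
    · rw [S.kappaIter_succ le_rfl, S.kappaIter_self, Category.comp_id, S.src_kappa]

lemma src_kappaIter_assoc {Z : C} (f : disk S.functor j ⟶ Z) :
    src S.functor h ≫ S.kappaIter h.le ≫ f = f := by
  rw [← Category.assoc, src_kappaIter, Category.id_comp]

lemma tgt_kappaIter : tgt S.functor h ≫ S.kappaIter h.le = 𝟙 _ := by
  induction i with
  | zero => exact absurd h (Nat.not_lt_zero j)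
  | succ i ih =>
    rcases Nat.lt_succ_iff_lt_or_eq.1 h with h' | rfl
    · rw [S.kappaIter_succ h'.le, ← tgt_tgt S.functor i.lt_succ_self h', Category.assoc,
        ← Category.assoc (tgt S.functor i.lt_succ_self), S.tgt_kappa, Category.id_comp, ih h']
    · rw [S.kappaIter_succ le_rfl, S.kappaIter_self, Category.comp_id, S.tgt_kappa]

lemma tgt_kappaIter_assoc {Z : C} (f : disk S.functor j ⟶ Z) :
    tgt S.functor h ≫ S.kappaIter h.le ≫ f = f := by
  rw [← Category.assoc, tgt_kappaIter, Category.id_comp]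

lemma src_nabla_low' {X : C} {k : ℕ} (h' : k < j) (a b : disk S.functor i ⟶ X)
    (e : src S.functor (h'.trans h) ≫ a = tgt S.functor (h'.trans h) ≫ b) :
    src S.functor h ≫ S.nabla (h'.trans h) ≫ S.copair (h'.trans h) a b e =
      S.nabla h' ≫ S.copair h' (src S.functor h ≫ a) (src S.functor h ≫ b)
        (by rw [src_src_assoc, tgt_src_assoc, e]) := by
  induction i with
  | zero => exact absurd h (Nat.not_lt_zero j)
  | succ i ih =>
    have key : ∀ (hk : k < i), src S.functor i.lt_succ_self ≫ S.nabla (h'.trans h) ≫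
        S.copair (h'.trans h) a b e = S.nabla hk ≫ S.copair hk
          (src S.functor i.lt_succ_self ≫ a) (src S.functor i.lt_succ_self ≫ b)
          (by rw [src_src_assoc, tgt_src_assoc, e]) := by
      intro hk
      rw [← Category.assoc, S.src_nabla_low hk, Category.assoc, IsGlobularUnder.copair_comp]
      simp
    rcases Nat.lt_succ_iff_lt_or_eq.1 h with h₁ | rfl
    · refine (src_src_assoc S.functor i.lt_succ_self h₁ _).symm.trans ?_
      rw [key (h'.trans h₁), ih h₁]
      congr 2
      · exact src_src_assoc S.functor i.lt_succ_self h₁ a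
      · exact src_src_assoc S.functor i.lt_succ_self h₁ b
    · exact key h'

lemma tgt_nabla_low' {X : C} {k : ℕ} (h' : k < j) (a b : disk S.functor i ⟶ X)
    (e : src S.functor (h'.trans h) ≫ a = tgt S.functor (h'.trans h) ≫ b) :
    tgt S.functor h ≫ S.nabla (h'.trans h) ≫ S.copair (h'.trans h) a b e =
      S.nabla h' ≫ S.copair h' (tgt S.functor h ≫ a) (tgt S.functor h ≫ b)
        (by rw [src_tgt_assoc, tgt_tgt_assoc, e]) := by
  induction i with
  | zero => exact absurd h (Nat.not_lt_zero j)
  | succ i ih =>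
    have key : ∀ (hk : k < i), tgt S.functor i.lt_succ_self ≫ S.nabla (h'.trans h) ≫
        S.copair (h'.trans h) a b e = S.nabla hk ≫ S.copair hk
          (tgt S.functor i.lt_succ_self ≫ a) (tgt S.functor i.lt_succ_self ≫ b)
          (by rw [src_tgt_assoc, tgt_tgt_assoc, e]) := by
      intro hk
      rw [← Category.assoc, S.tgt_nabla_low hk, Category.assoc, IsGlobularUnder.copair_comp]
      simp
    rcases Nat.lt_succ_iff_lt_or_eq.1 h with h₁ | rfl
    · refine (tgt_tgt_assoc S.functor i.lt_succ_self h₁ _).symm.trans ?_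
      rw [key (h'.trans h₁), ih h₁]
      congr 2
      · exact tgt_tgt_assoc S.functor i.lt_succ_self h₁ a
      · exact tgt_tgt_assoc S.functor i.lt_succ_self h₁ b
    · exact key h'

variable {X : C} (a b : disk S.functor i ⟶ X) (e : src S.functor h ≫ a = tgt S.functor h ≫ b)

lemma src_nabla_self :
    src S.functor h ≫ S.nabla h ≫ S.copair h a b e = src S.functor h ≫ b := by
  induction i with
  | zero => exact absurd h (Nat.not_lt_zero j)
  | succ i ih =>
    rcases Nat.lt_succ_iff_lt_or_eq.1 h with h' | rfl
    · rw [← src_src S.functor i.lt_succ_self h', Category.assoc,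
        S.src_nabla_low' i.lt_succ_self h', ih h', Category.assoc]
    · rw [← Category.assoc, S.src_nabla_top, Category.assoc, IsGlobularUnder.eps₂_copair]

lemma tgt_nabla_self :
    tgt S.functor h ≫ S.nabla h ≫ S.copair h a b e = tgt S.functor h ≫ a := by
  induction i with
  | zero => exact absurd h (Nat.not_lt_zero j)
  | succ i ih =>
    rcases Nat.lt_succ_iff_lt_or_eq.1 h with h' | rfl
    · rw [← tgt_tgt S.functor i.lt_succ_self h', Category.assoc,
        S.tgt_nabla_low' i.lt_succ_self h', ih h', Category.assoc]
    · rw [← Category.assoc, S.tgt_nabla_top, Category.assoc, IsGlobularUnder.eps₁_copair]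

/-- below the gluing dimension -/
lemma src_nabla_lower {k : ℕ} (h' : k < j) :
    src S.functor (h'.trans h) ≫ S.nabla h ≫ S.copair h a b e =
      src S.functor (h'.trans h) ≫ b := by
  rw [← src_src S.functor h h', Category.assoc, src_nabla_self, Category.assoc]

lemma tgt_nabla_lower {k : ℕ} (h' : k < j) :
    tgt S.functor (h'.trans h) ≫ S.nabla h ≫ S.copair h a b e =
      tgt S.functor (h'.trans h) ≫ a := by
  rw [← tgt_tgt S.functor h h', Category.assoc, tgt_nabla_self, Category.assoc]

lemma src_epsQuad₀₂ {k : ℕ} (h' : k < j) :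
    src S.functor (h'.trans h) ≫ epsQuad S.functor h h' 0 =
      tgt S.functor (h'.trans h) ≫ epsQuad S.functor h h' 2 := by
  rw [← src_src S.functor h h', Category.assoc, src_epsQuad₀, src_tgt_assoc, src_epsQuad₁]

lemma src_epsQuad₁₃ {k : ℕ} (h' : k < j) :
    src S.functor (h'.trans h) ≫ epsQuad S.functor h h' 1 =
      tgt S.functor (h'.trans h) ≫ epsQuad S.functor h h' 3 := by
  rw [src_epsQuad₁, ← tgt_src_assoc S.functor h h' (epsQuad S.functor h h' 2), src_epsQuad₂,
    tgt_tgt_assoc]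

end

/-- The axioms of categorical globular extensions.  In the exchange axiom, both
`(D i ⨿_{D j} D i) ⨿_{D k} (D i ⨿_{D j} D i)` and
`(D i ⨿_{D k} D i) ⨿_{D j ⨿_{D k} D j} (D i ⨿_{D k} D i)` are identified with the globular sum
`D i ⨿_{D j} D i ⨿_{D k} D i ⨿_{D j} D i`; in the unit axioms, `D j ⨿_{D j} D i` and
`D i ⨿_{D j} D j` are identified with `D i`. -/
structure IsCategorical : Prop where
  ass {i j : ℕ} (h : j < i) :
    S.nabla h ≫ S.copair h (epsTriple S.functor h 0)
        (S.nabla h ≫ S.copair h (epsTriple S.functor h 1) (epsTriple S.functor h 2)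
          (src_epsTriple₁ S.functor h))
        (by rw [tgt_nabla_self, src_epsTriple₀]) =
      S.nabla h ≫ S.copair h
        (S.nabla h ≫ S.copair h (epsTriple S.functor h 0) (epsTriple S.functor h 1)
          (src_epsTriple₀ S.functor h))
        (epsTriple S.functor h 2)
        (by rw [src_nabla_self, src_epsTriple₁])
  exc {i j k : ℕ} (h : j < i) (h' : k < j) :
    S.nabla (h'.trans h) ≫ S.copair (h'.trans h)
        (S.nabla h ≫ S.copair h (epsQuad S.functor h h' 0) (epsQuad S.functor h h' 1)
          (src_epsQuad₀ S.functor h h'))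
        (S.nabla h ≫ S.copair h (epsQuad S.functor h h' 2) (epsQuad S.functor h h' 3)
          (src_epsQuad₂ S.functor h h'))
        (by rw [S.src_nabla_lower h _ _ _ h', S.tgt_nabla_lower h _ _ _ h', src_epsQuad₁]) =
      S.nabla h ≫ S.copair h
        (S.nabla (h'.trans h) ≫ S.copair (h'.trans h) (epsQuad S.functor h h' 0)
          (epsQuad S.functor h h' 2) (S.src_epsQuad₀₂ h h'))
        (S.nabla (h'.trans h) ≫ S.copair (h'.trans h) (epsQuad S.functor h h' 1)
          (epsQuad S.functor h h' 3) (S.src_epsQuad₁₃ h h'))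
        (by
          rw [S.src_nabla_low' h h', S.tgt_nabla_low' h h']
          congr 2
          · exact src_epsQuad₀ S.functor h h'
          · exact src_epsQuad₂ S.functor h h')
  lun {i j : ℕ} (h : j < i) :
    S.nabla h ≫ S.copair h (S.kappaIter h.le ≫ tgt S.functor h) (𝟙 _)
      (by rw [src_kappaIter_assoc, Category.comp_id]) = 𝟙 _
  run {i j : ℕ} (h : j < i) :
    S.nabla h ≫ S.copair h (𝟙 _) (S.kappaIter h.le ≫ src S.functor h)
      (by rw [tgt_kappaIter_assoc, Category.comp_id]) = 𝟙 _
  func {i j : ℕ} (h : j < i) :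
    S.kappa i ≫ S.nabla h =
      S.nabla (h.trans i.lt_succ_self) ≫ S.copair (h.trans i.lt_succ_self)
        (S.kappa i ≫ eps₁ S.functor h) (S.kappa i ≫ eps₂ S.functor h)
        (by
          rw [← src_src_assoc S.functor i.lt_succ_self h, ← tgt_tgt_assoc S.functor i.lt_succ_self h,
            ← Category.assoc (src S.functor i.lt_succ_self), S.src_kappa,
            ← Category.assoc (tgt S.functor i.lt_succ_self), S.tgt_kappa,
            Category.id_comp, Category.id_comp, src_eps₁])

end PrecatStructure

/-- The structure of a categorical globular extension on a category `C`. -/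
structure CatStructure (C : Type w) [Category.{v} C] extends PrecatStructure.{u} C where
  isCategorical : toPrecatStructure.IsCategorical

namespace CatStructure

section ExtCat

variable {C : Type w} [Category.{v} C]

/-- Morphisms between categorical globular extension structures on `C`: natural transformations
that are natural with respect to the morphisms of `Θ₀` as well as to the operations `nabla`
and `kappa`. -/
@[ext]
structure Hom (S S' : CatStructure.{u} C) where
  app : S.functor ⟶ S'.functor
  nabla_app {i j : ℕ} (h : j < i) :
    S.nabla h ≫ app.app (Table.pair h).obj = app.app (globeToTheta0.obj (D i)) ≫ S'.nabla h
  kappa_app (i : ℕ) :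
    S.kappa i ≫ app.app (globeToTheta0.obj (D i)) =
      app.app (globeToTheta0.obj (D (i + 1))) ≫ S'.kappa i

/-- The category of categorical globular extension structures on `C`. -/
noncomputable instance : Category (CatStructure.{u} C) where
  Hom := Hom
  id S :=
    { app := 𝟙 _
      nabla_app := fun _ => (Category.comp_id _).trans (Category.id_comp _).symm
      kappa_app := fun _ => (Category.comp_id _).trans (Category.id_comp _).symm }
  comp f g :=
    { app := f.app ≫ g.app
      nabla_app := fun h => by
        rw [NatTrans.comp_app, ← Category.assoc, f.nabla_app, Category.assoc, g.nabla_app,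
          NatTrans.comp_app, Category.assoc]
      kappa_app := fun i => by
        rw [NatTrans.comp_app, ← Category.assoc, f.kappa_app, Category.assoc, g.kappa_app,
          NatTrans.comp_app, Category.assoc] }
  id_comp f := Hom.ext (Category.id_comp _)
  comp_id f := Hom.ext (Category.comp_id _)
  assoc f g h := Hom.ext (Category.assoc _ _ _)

end ExtCat

end CatStructure

section Image

variable {C : Type w} [Category.{v} C] {E : Type w'} [Category.{v} E]

lemma IsGlobularUnder.map_copair {G : Theta0.{u} ⥤ C} (hG : IsGlobularUnder G) (H : C ⥤ E)
    (hH : IsGlobularUnder (G ⋙ H)) {i j : ℕ} (h : j < i) {X : C} (a b : disk G i ⟶ X)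
    (e : src G h ≫ a = tgt G h ≫ b) :
    H.map (hG.copair h a b e) = hH.copair h (H.map a) (H.map b)
      (by simpa using congrArg H.map e) := by
  apply hH.pair_ext h
  · rw [hH.eps₁_copair]
    exact (H.map_comp _ _).symm.trans (congrArg H.map (hG.eps₁_copair h a b e))
  · rw [hH.eps₂_copair]
    exact (H.map_comp _ _).symm.trans (congrArg H.map (hG.eps₂_copair h a b e))

/-- The image of a precategorical globular extension structure by a functor which respects
globular sums. -/
noncomputable def PrecatStructure.image (S : PrecatStructure.{u} C) (H : C ⥤ E)
    (hH : IsGlobularUnder (S.functor ⋙ H)) : PrecatStructure.{u} E where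
  functor := S.functor ⋙ H
  isGlobular := hH
  nabla h := H.map (S.nabla h)
  kappa i := H.map (S.kappa i)
  src_nabla_top i := by
    have := congrArg H.map (S.src_nabla_top i)
    rw [H.map_comp, H.map_comp] at this
    exact this
  src_nabla_low {i j} h := by
    have := congrArg H.map (S.src_nabla_low h)
    rw [H.map_comp, H.map_comp, IsGlobularUnder.map_copair _ H hH] at this
    simp only [H.map_comp] at this
    exact this
  tgt_nabla_top i := by
    have := congrArg H.map (S.tgt_nabla_top i)
    rw [H.map_comp, H.map_comp] at this
    exact this
  tgt_nabla_low {i j} h := by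
    have := congrArg H.map (S.tgt_nabla_low h)
    rw [H.map_comp, H.map_comp, IsGlobularUnder.map_copair _ H hH] at this
    simp only [H.map_comp] at this
    exact this
  src_kappa i := by
    have := congrArg H.map (S.src_kappa i)
    rw [H.map_comp, H.map_id] at this
    exact this
  tgt_kappa i := by
    have := congrArg H.map (S.tgt_kappa i)
    rw [H.map_comp, H.map_id] at this
    exact this

lemma PrecatStructure.image_kappaIter (S : PrecatStructure.{u} C) (H : C ⥤ E)
    (hH : IsGlobularUnder (S.functor ⋙ H)) {i j : ℕ} (h : j ≤ i) :
    (S.image H hH).kappaIter h = H.map (S.kappaIter h) := by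
  induction i, h using Nat.le_induction with
  | base => rw [kappaIter_self, kappaIter_self, H.map_id]; rfl
  | succ i h ih =>
    refine ((S.image H hH).kappaIter_succ h).trans ?_
    rw [ih, S.kappaIter_succ, H.map_comp]; rfl

lemma PrecatStructure.IsCategorical.image {S : PrecatStructure.{u} C} (hS : S.IsCategorical)
    (H : C ⥤ E) (hH : IsGlobularUnder (S.functor ⋙ H)) : (S.image H hH).IsCategorical where
  ass h := by
    have := congrArg H.map (hS.ass h)
    simp only [H.map_comp, IsGlobularUnder.map_copair _ H hH] at this
    exact this
  exc h h' := by
    have := congrArg H.map (hS.exc h h')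
    simp only [H.map_comp, IsGlobularUnder.map_copair _ H hH] at this
    exact this
  lun h := by
    have := congrArg H.map (hS.lun h)
    simp only [H.map_comp, IsGlobularUnder.map_copair _ H hH, H.map_id] at this
    simp only [S.image_kappaIter]
    exact this
  run h := by
    have := congrArg H.map (hS.run h)
    simp only [H.map_comp, IsGlobularUnder.map_copair _ H hH, H.map_id] at this
    simp only [S.image_kappaIter]
    exact this
  func h := by
    have := congrArg H.map (hS.func h)
    simp only [H.map_comp, IsGlobularUnder.map_copair _ H hH] at this
    exact this

end Image

namespace CatStructure

variable {Θ : Type v} [Category.{u} Θ] (S : CatStructure.{u} Θ)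

/-- The category of functors `Θ ⥤ C` under `Θ₀` which make `C` a globular extension
under `Θ₀`. -/
abbrev HomTheta0 (C : Type w) [Category.{u} C] : Type _ :=
  ObjectProperty.FullSubcategory (fun H : Θ ⥤ C => IsGlobularUnder (S.functor ⋙ H))

/-- The functor induced by precomposition by `Θ₀ ⥤ Θ`, from the category of functors `Θ ⥤ C`
which make `C` a globular extension under `Θ₀` to the category of categorical globular extension
structures on `C`. -/
noncomputable def restrict (C : Type w) [Category.{u} C] :
    S.HomTheta0 C ⥤ CatStructure.{u} C where
  obj H :=
    { toPrecatStructure := S.toPrecatStructure.image H.obj H.property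
      isCategorical := S.isCategorical.image H.obj H.property }
  map α :=
    { app := Functor.whiskerLeft S.functor α.hom
      nabla_app := fun h => α.hom.naturality (S.nabla h)
      kappa_app := fun i => α.hom.naturality (S.kappa i) }
  map_id _ := rfl
  map_comp _ _ := rfl

/-- The universal property of `Θ`: for every category `C`, precomposition by `Θ₀ ⥤ Θ` is an
isomorphism of categories onto the category of categorical globular extension structures. -/
def IsUniversal {Θ : Type u} [Category.{u} Θ] (S : CatStructure.{u} Θ) : Prop :=
  ∀ (C : Type (u + 1)) [Category.{u} C], (S.restrict C).IsIso

end CatStructure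

/-! ## Strict `∞`-categories -/

/-- A globular set. -/
abbrev GlobularSet : Type (u + 1) := Globe.{u}ᵒᵖ ⥤ Type u

namespace GlobularSet

/-- The set of `i`-cells of a globular set. -/
abbrev cell (X : GlobularSet.{u}) (i : ℕ) : Type u := X.obj (op (D i))

/-- The iterated source map from `i`-cells to `j`-cells, for `j < i`. -/
abbrev s (X : GlobularSet.{u}) {i j : ℕ} (h : j < i) (x : X.cell i) : X.cell j :=
  X.map (sigma h).op x

/-- The iterated target map from `i`-cells to `j`-cells, for `j < i`. -/
abbrev t (X : GlobularSet.{u}) {i j : ℕ} (h : j < i) (x : X.cell i) : X.cell j :=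
  X.map (tau h).op x

variable (X : GlobularSet.{u}) {i j k : ℕ} (h : j < i) (h' : k < j) (x : X.cell i)

lemma s_s : X.s h' (X.s h x) = X.s (h'.trans h) x := by
  simp only [s, ← Functor.map_comp_apply, ← op_comp, sigma_sigma]

lemma t_s : X.t h' (X.s h x) = X.t (h'.trans h) x := by
  simp only [s, t, ← Functor.map_comp_apply, ← op_comp, tau_sigma]

lemma s_t : X.s h' (X.t h x) = X.s (h'.trans h) x := by
  simp only [s, t, ← Functor.map_comp_apply, ← op_comp, sigma_tau]

lemma t_t : X.t h' (X.t h x) = X.t (h'.trans h) x := by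
  simp only [t, ← Functor.map_comp_apply, ← op_comp, tau_tau]

end GlobularSet

/-- An `∞`-precategory: a globular set with compositions `u ∗ⁱⱼ v`, defined when the `j`-source of
`u` is the `j`-target of `v`, and with units. -/
structure InfPrecat where
  /-- the underlying globular set -/
  cells : GlobularSet.{u}
  comp {i j : ℕ} (h : j < i) (a b : cells.cell i) (e : cells.s h a = cells.t h b) : cells.cell i
  unit {i : ℕ} (a : cells.cell i) : cells.cell (i + 1)
  s_comp_top {i : ℕ} (a b : cells.cell (i + 1))
    (e : cells.s i.lt_succ_self a = cells.t i.lt_succ_self b) :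
    cells.s i.lt_succ_self (comp i.lt_succ_self a b e) = cells.s i.lt_succ_self b
  s_comp_low {i j : ℕ} (h : j < i) (a b : cells.cell (i + 1))
    (e : cells.s (h.trans i.lt_succ_self) a = cells.t (h.trans i.lt_succ_self) b) :
    cells.s i.lt_succ_self (comp (h.trans i.lt_succ_self) a b e) =
      comp h (cells.s i.lt_succ_self a) (cells.s i.lt_succ_self b)
        (by rw [cells.s_s, cells.t_s, e])
  t_comp_top {i : ℕ} (a b : cells.cell (i + 1))
    (e : cells.s i.lt_succ_self a = cells.t i.lt_succ_self b) :
    cells.t i.lt_succ_self (comp i.lt_succ_self a b e) = cells.t i.lt_succ_self a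
  t_comp_low {i j : ℕ} (h : j < i) (a b : cells.cell (i + 1))
    (e : cells.s (h.trans i.lt_succ_self) a = cells.t (h.trans i.lt_succ_self) b) :
    cells.t i.lt_succ_self (comp (h.trans i.lt_succ_self) a b e) =
      comp h (cells.t i.lt_succ_self a) (cells.t i.lt_succ_self b)
        (by rw [cells.s_t, cells.t_t, e])
  s_unit {i : ℕ} (a : cells.cell i) : cells.s i.lt_succ_self (unit a) = a
  t_unit {i : ℕ} (a : cells.cell i) : cells.t i.lt_succ_self (unit a) = a

namespace InfPrecat

lemma hom_comp_compat {X Y : GlobularSet.{u}} (f : X ⟶ Y) {i j : ℕ} (h : j < i) {a b : X.cell i}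
    (e : X.s h a = X.t h b) : Y.s h (f.app _ a) = Y.t h (f.app _ b) := by
  simp only [GlobularSet.s, GlobularSet.t, ← NatTrans.naturality_apply] at e ⊢
  rw [e]

/-- Morphisms of `∞`-precategories. -/
@[ext]
structure Hom (X Y : InfPrecat.{u}) where
  app : X.cells ⟶ Y.cells
  app_comp {i j : ℕ} (h : j < i) (a b : X.cells.cell i) (e : X.cells.s h a = X.cells.t h b) :
    app.app (op (D i)) (X.comp h a b e) =
      Y.comp h (app.app (op (D i)) a) (app.app (op (D i)) b) (hom_comp_compat app h e)
  app_unit {i : ℕ} (a : X.cells.cell i) :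
    app.app (op (D (i + 1))) (X.unit a) = Y.unit (app.app (op (D i)) a)

/-- The category of `∞`-precategories. -/
instance : Category InfPrecat.{u} where
  Hom := Hom
  id X :=
    { app := 𝟙 _
      app_comp := fun _ _ _ _ => rfl
      app_unit := fun _ => rfl }
  comp f g :=
    { app := f.app ≫ g.app
      app_comp := fun h a b e => by
        simp only [NatTrans.comp_app, types_comp_apply, f.app_comp, g.app_comp]
      app_unit := fun a => by
        simp only [NatTrans.comp_app, types_comp_apply, f.app_unit, g.app_unit] }
  id_comp f := Hom.ext (Category.id_comp _)
  comp_id f := Hom.ext (Category.comp_id _)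
  assoc f g h := Hom.ext (Category.assoc _ _ _)

variable (X : InfPrecat.{u})

/-- The iterated unit map from `j`-cells to `i`-cells, for `j ≤ i`. -/
def unitIter {i j : ℕ} (h : j ≤ i) (a : X.cells.cell j) : X.cells.cell i :=
  Nat.leRec (motive := fun i _ => X.cells.cell i) a (fun _ _ x => X.unit x) h

lemma unitIter_self {j : ℕ} (a : X.cells.cell j) : X.unitIter le_rfl a = a :=
  Nat.leRec_self _ _

lemma unitIter_succ {i j : ℕ} (h : j ≤ i) (a : X.cells.cell j) :
    X.unitIter (h.trans i.le_succ) a = X.unit (X.unitIter h a) :=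
  Nat.leRec_succ _ _ _

section

variable {i j : ℕ} (h : j < i)

lemma s_unitIter (a : X.cells.cell j) : X.cells.s h (X.unitIter h.le a) = a := by
  induction i with
  | zero => exact absurd h (Nat.not_lt_zero j)
  | succ i ih =>
    rcases Nat.lt_succ_iff_lt_or_eq.1 h with h' | rfl
    · rw [X.unitIter_succ h'.le, ← X.cells.s_s i.lt_succ_self h', X.s_unit, ih h']
    · rw [X.unitIter_succ le_rfl, X.s_unit, X.unitIter_self]

lemma t_unitIter (a : X.cells.cell j) : X.cells.t h (X.unitIter h.le a) = a := by
  induction i with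
  | zero => exact absurd h (Nat.not_lt_zero j)
  | succ i ih =>
    rcases Nat.lt_succ_iff_lt_or_eq.1 h with h' | rfl
    · rw [X.unitIter_succ h'.le, ← X.cells.t_t i.lt_succ_self h', X.t_unit, ih h']
    · rw [X.unitIter_succ le_rfl, X.t_unit, X.unitIter_self]

lemma comp_congr {a a' b b' : X.cells.cell i} (ha : a = a') (hb : b = b')
    (e : X.cells.s h a = X.cells.t h b) :
    X.comp h a b e = X.comp h a' b' (by rw [← ha, ← hb, e]) := by
  subst ha hb; rfl

lemma s_comp_of_lt {k : ℕ} (h' : k < j) (a b : X.cells.cell i)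
    (e : X.cells.s (h'.trans h) a = X.cells.t (h'.trans h) b) :
    X.cells.s h (X.comp (h'.trans h) a b e) = X.comp h' (X.cells.s h a) (X.cells.s h b)
      (by rw [X.cells.s_s, X.cells.t_s, e]) := by
  induction i with
  | zero => exact absurd h (Nat.not_lt_zero j)
  | succ i ih =>
    rcases Nat.lt_succ_iff_lt_or_eq.1 h with h₁ | rfl
    · rw [← X.cells.s_s i.lt_succ_self h₁, X.s_comp_low (h'.trans h₁), ih h₁]
      exact X.comp_congr _ (X.cells.s_s _ _ _) (X.cells.s_s _ _ _) _
    · exact X.s_comp_low h' a b e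

lemma t_comp_of_lt {k : ℕ} (h' : k < j) (a b : X.cells.cell i)
    (e : X.cells.s (h'.trans h) a = X.cells.t (h'.trans h) b) :
    X.cells.t h (X.comp (h'.trans h) a b e) = X.comp h' (X.cells.t h a) (X.cells.t h b)
      (by rw [X.cells.s_t, X.cells.t_t, e]) := by
  induction i with
  | zero => exact absurd h (Nat.not_lt_zero j)
  | succ i ih =>
    rcases Nat.lt_succ_iff_lt_or_eq.1 h with h₁ | rfl
    · rw [← X.cells.t_t i.lt_succ_self h₁, X.t_comp_low (h'.trans h₁), ih h₁]
      exact X.comp_congr _ (X.cells.t_t _ _ _) (X.cells.t_t _ _ _) _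
    · exact X.t_comp_low h' a b e

variable (a b : X.cells.cell i) (e : X.cells.s h a = X.cells.t h b)

lemma s_comp_self : X.cells.s h (X.comp h a b e) = X.cells.s h b := by
  induction i with
  | zero => exact absurd h (Nat.not_lt_zero j)
  | succ i ih =>
    rcases Nat.lt_succ_iff_lt_or_eq.1 h with h' | rfl
    · rw [← X.cells.s_s i.lt_succ_self h', X.s_comp_low h', ih h', X.cells.s_s]
    · exact X.s_comp_top a b e

lemma t_comp_self : X.cells.t h (X.comp h a b e) = X.cells.t h a := by
  induction i with
  | zero => exact absurd h (Nat.not_lt_zero j)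
  | succ i ih =>
    rcases Nat.lt_succ_iff_lt_or_eq.1 h with h' | rfl
    · rw [← X.cells.t_t i.lt_succ_self h', X.t_comp_low h', ih h', X.cells.t_t]
    · exact X.t_comp_top a b e

lemma s_comp_lower {k : ℕ} (h' : k < j) :
    X.cells.s (h'.trans h) (X.comp h a b e) = X.cells.s (h'.trans h) b := by
  rw [← X.cells.s_s h h', s_comp_self, X.cells.s_s]

lemma t_comp_lower {k : ℕ} (h' : k < j) :
    X.cells.t (h'.trans h) (X.comp h a b e) = X.cells.t (h'.trans h) a := by
  rw [← X.cells.t_t h h', t_comp_self, X.cells.t_t]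

end

lemma exc_left {i j k : ℕ} (h : j < i) (h' : k < j) {a a' b : X.cells.cell i}
    (e₁ : X.cells.s h a = X.cells.t h a')
    (e₂ : X.cells.s (h'.trans h) a' = X.cells.t (h'.trans h) b) :
    X.cells.s (h'.trans h) a = X.cells.t (h'.trans h) b := by
  rw [← X.cells.s_s h h', e₁, X.cells.s_t, e₂]

lemma exc_right {i j k : ℕ} (h : j < i) (h' : k < j) {a' b b' : X.cells.cell i}
    (e₂ : X.cells.s (h'.trans h) a' = X.cells.t (h'.trans h) b)
    (e₃ : X.cells.s h b = X.cells.t h b') :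
    X.cells.s (h'.trans h) a' = X.cells.t (h'.trans h) b' := by
  rw [e₂, ← X.cells.t_s h h', e₃, X.cells.t_t]

/-- The axioms of strict `∞`-categories. -/
structure IsStrict : Prop where
  ass {i j : ℕ} (h : j < i) (a b c : X.cells.cell i) (e : X.cells.s h a = X.cells.t h b)
    (e' : X.cells.s h b = X.cells.t h c) :
    X.comp h (X.comp h a b e) c (by rw [s_comp_self, e']) =
      X.comp h a (X.comp h b c e') (by rw [t_comp_self, e])
  exc {i j k : ℕ} (h : j < i) (h' : k < j) (a a' b b' : X.cells.cell i)
    (e₁ : X.cells.s h a = X.cells.t h a')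
    (e₂ : X.cells.s (h'.trans h) a' = X.cells.t (h'.trans h) b)
    (e₃ : X.cells.s h b = X.cells.t h b') :
    X.comp (h'.trans h) (X.comp h a a' e₁) (X.comp h b b' e₃)
        (by rw [X.s_comp_lower h _ _ _ h', X.t_comp_lower h _ _ _ h', e₂]) =
      X.comp h (X.comp (h'.trans h) a b (X.exc_left h h' e₁ e₂))
        (X.comp (h'.trans h) a' b' (X.exc_right h h' e₂ e₃))
        (by
          rw [X.s_comp_of_lt h h', X.t_comp_of_lt h h']
          exact X.comp_congr h' e₁ e₃ (by rw [X.cells.s_s, X.cells.t_s, X.exc_left h h' e₁ e₂]))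
  lun {i j : ℕ} (h : j < i) (a : X.cells.cell i) :
    X.comp h (X.unitIter h.le (X.cells.t h a)) a (by rw [s_unitIter]) = a
  run {i j : ℕ} (h : j < i) (a : X.cells.cell i) :
    X.comp h a (X.unitIter h.le (X.cells.s h a)) (by rw [t_unitIter]) = a
  func {i j : ℕ} (h : j < i) (a b : X.cells.cell i) (e : X.cells.s h a = X.cells.t h b) :
    X.unit (X.comp h a b e) =
      X.comp (h.trans i.lt_succ_self) (X.unit a) (X.unit b)
        (by rw [← X.cells.s_s i.lt_succ_self h, ← X.cells.t_t i.lt_succ_self h, X.s_unit,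
          X.t_unit, e])

end InfPrecat

/-- The category of strict `∞`-categories, a full subcategory of the category of
`∞`-precategories. -/
abbrev InfCat : Type (u + 1) :=
  ObjectProperty.FullSubcategory (fun X : InfPrecat.{u} => X.IsStrict)

/-- The forgetful functor from strict `∞`-categories to globular sets. -/
def InfCat.forget : InfCat.{u} ⥤ GlobularSet.{u} where
  obj X := X.obj.cells
  map f := f.hom.app
  map_id _ := rfl
  map_comp _ _ := rfl

/-! ## Globular presheaves and the associated strict `∞`-categories -/

/-- Globular presheaves on a globular extension `(C, F)`: the presheaves sending globular sums to
limits. -/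
def IsGlobularPresheaf {C : Type w} [Category.{v} C] (F : Globe.{u} ⥤ C) :
    ObjectProperty (Cᵒᵖ ⥤ Type v) :=
  fun X => ∀ T : Table, PreservesLimit (T.index F).multispan.op X

/-- The category `Mod(C)` of globular presheaves on a globular extension `(C, F)`. -/
abbrev Mod {C : Type w} [Category.{v} C] (F : Globe.{u} ⥤ C) : Type _ :=
  (IsGlobularPresheaf F).FullSubcategory

/-- The functor `C ⥤ Mod(C)` induced by the Yoneda functor. -/
def yonedaMod {C : Type w} [Category.{v} C] (F : Globe.{u} ⥤ C) : C ⥤ Mod F :=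
  (IsGlobularPresheaf F).lift yoneda (fun _ _ => inferInstance)

lemma existsUnique_elem {C : Type w} [Category.{u} C] {G : Theta0.{u} ⥤ C}
    (hG : IsGlobularUnder G) {X : Cᵒᵖ ⥤ Type u}
    (hX : IsGlobularPresheaf (globeToTheta0 ⋙ G) X) (T : Table) (x : ∀ k : Fin (T.n + 1), X.obj (op (disk G (T.dim k))))
    (hx : ∀ k : Fin T.n, X.map (src G (T.gap_lt_left k)).op (x k.castSucc) =
      X.map (tgt G (T.gap_lt_right k)).op (x k.succ)) :
    ∃! y : X.obj (op (G.obj T.obj)), ∀ k, X.map (eps G T k).op y = x k := by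
  have := hX T
  have hl := (Types.isLimit_iff _).1 ⟨isLimitOfPreserves X (hG.isSum T).some.op⟩
  obtain ⟨y, hy, hy'⟩ := hl
    (fun j => match j with
      | op (.left k) => X.map (src G (T.gap_lt_left k)).op (x k.castSucc)
      | op (.right k) => x k)
    (by
      rintro ⟨_ | _⟩ ⟨_ | _⟩ ⟨_ | _ | _⟩
      · exact Functor.map_id_apply ((T.index (globeToTheta0 ⋙ G)).multispan.op ⋙ X) _ _
      · rfl
      · exact (hx _).symm
      · exact Functor.map_id_apply ((T.index (globeToTheta0 ⋙ G)).multispan.op ⋙ X) _ _)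
  refine ⟨y, fun k => hy (op (.right k)), fun z hz => hy' z ?_⟩
  rintro ⟨k | k⟩
  · refine (Functor.map_comp_apply X (eps G T k.castSucc).op
      (src G (T.gap_lt_left k)).op z).trans ?_
    rw [hz]
  · exact hz k

namespace PrecatStructure

variable {C : Type w} [Category.{u} C] (S : PrecatStructure.{u} C)

/-- The underlying globular set of a presheaf. -/
noncomputable abbrev cellsOf (X : Cᵒᵖ ⥤ Type u) : GlobularSet.{u} :=
  (globeToTheta0 ⋙ S.functor).op ⋙ X

section

variable {S} {X : Cᵒᵖ ⥤ Type u} (hX : IsGlobularPresheaf (globeToTheta0 ⋙ S.functor) X)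

lemma existsUnique_pairElem (hX : IsGlobularPresheaf (globeToTheta0 ⋙ S.functor) X) {i j : ℕ} (h : j < i) (a b : (S.cellsOf X).cell i)
    (e : (S.cellsOf X).s h a = (S.cellsOf X).t h b) :
    ∃! y : X.obj (op (pairObj S.functor h)),
      X.map (eps₁ S.functor h).op y = a ∧ X.map (eps₂ S.functor h).op y = b := by
  obtain ⟨y, hy, hy'⟩ := existsUnique_elem S.isGlobular hX (Table.pair h)
    (fun (k : Fin 2) => match k with
      | 0 => a
      | 1 => b)
    (fun (k : Fin 1) => match k with
      | 0 => e)
  refine ⟨y, ⟨hy (0 : Fin 2), hy (1 : Fin 2)⟩, fun z hz => hy' z (fun (k : Fin 2) => ?_)⟩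
  match k with
  | 0 => exact hz.1
  | 1 => exact hz.2

/-- The element of `X (D i ⨿_{D j} D i)` corresponding to a pair of composable cells, under the
bijection of `X (D i ⨿_{D j} D i)` with the fibre product of `X (D i)` and `X (D i)`
over `X (D j)`. -/
noncomputable def pairElem {i j : ℕ} (h : j < i) (a b : (S.cellsOf X).cell i)
    (e : (S.cellsOf X).s h a = (S.cellsOf X).t h b) : X.obj (op (pairObj S.functor h)) :=
  (existsUnique_pairElem hX h a b e).choose

lemma pairElem_eq {i j : ℕ} (h : j < i) {a b : (S.cellsOf X).cell i}
    (e : (S.cellsOf X).s h a = (S.cellsOf X).t h b) (y : X.obj (op (pairObj S.functor h)))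
    (h₁ : X.map (eps₁ S.functor h).op y = a) (h₂ : X.map (eps₂ S.functor h).op y = b) :
    y = pairElem hX h a b e :=
  (existsUnique_pairElem hX h a b e).choose_spec.2 y ⟨h₁, h₂⟩

lemma eps₁_pairElem {i j : ℕ} (h : j < i) (a b : (S.cellsOf X).cell i)
    (e : (S.cellsOf X).s h a = (S.cellsOf X).t h b) :
    X.map (eps₁ S.functor h).op (pairElem hX h a b e) = a :=
  (existsUnique_pairElem hX h a b e).choose_spec.1.1

lemma eps₂_pairElem {i j : ℕ} (h : j < i) (a b : (S.cellsOf X).cell i)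
    (e : (S.cellsOf X).s h a = (S.cellsOf X).t h b) :
    X.map (eps₂ S.functor h).op (pairElem hX h a b e) = b :=
  (existsUnique_pairElem hX h a b e).choose_spec.1.2

/-- The composition induced by `nabla` on the cells of a globular presheaf. -/
noncomputable def compElem {i j : ℕ} (h : j < i) (a b : (S.cellsOf X).cell i)
    (e : (S.cellsOf X).s h a = (S.cellsOf X).t h b) : (S.cellsOf X).cell i :=
  X.map (S.nabla h).op (pairElem hX h a b e)

lemma cells_compat {i j : ℕ} {h : j < i} {Y : C} {a b : disk S.functor i ⟶ Y}
    (e : src S.functor h ≫ a = tgt S.functor h ≫ b) (y : X.obj (op Y)) :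
    (S.cellsOf X).s h (X.map a.op y) = (S.cellsOf X).t h (X.map b.op y) := by
  refine (Functor.map_comp_apply X a.op (src S.functor h).op y).symm.trans ?_
  refine Eq.trans ?_ (Functor.map_comp_apply X b.op (tgt S.functor h).op y)
  rw [← op_comp, ← op_comp, e]

lemma map_nabla_copair {i j : ℕ} (h : j < i) {Y : C} (a b : disk S.functor i ⟶ Y)
    (e : src S.functor h ≫ a = tgt S.functor h ≫ b) (y : X.obj (op Y)) :
    X.map (S.nabla h ≫ S.copair h a b e).op y =
      compElem hX h (X.map a.op y) (X.map b.op y) (cells_compat e y) := by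
  rw [op_comp, Functor.map_comp_apply, compElem]
  congr 1
  apply pairElem_eq
  · rw [← Functor.map_comp_apply, ← op_comp, IsGlobularUnder.eps₁_copair]
  · rw [← Functor.map_comp_apply, ← op_comp, IsGlobularUnder.eps₂_copair]

lemma compElem_congr {i j : ℕ} (h : j < i) {a a' b b' : (S.cellsOf X).cell i} (ha : a = a')
    (hb : b = b') (e : (S.cellsOf X).s h a = (S.cellsOf X).t h b) :
    compElem hX h a b e = compElem hX h a' b' (by rw [← ha, ← hb, e]) := by
  subst ha hb; rfl

/-- The `∞`-precategory associated to a globular presheaf on a precategorical globular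
extension. -/
noncomputable def infPrecat : InfPrecat.{u} where
  cells := S.cellsOf X
  comp h a b e := compElem hX h a b e
  unit {i} a := X.map (S.kappa i).op a
  s_comp_top {i} a b e := by
    refine (Functor.map_comp_apply X (S.nabla _).op (src S.functor _).op _).symm.trans ?_
    rw [← op_comp, S.src_nabla_top, op_comp, Functor.map_comp_apply, eps₂_pairElem]
    rfl
  s_comp_low {i j} h a b e := by
    refine (Functor.map_comp_apply X (S.nabla _).op (src S.functor _).op _).symm.trans ?_
    rw [← op_comp, S.src_nabla_low h]
    refine (map_nabla_copair hX h _ _ _ _).trans (compElem_congr hX h ?_ ?_ _)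
    · rw [op_comp, Functor.map_comp_apply, eps₁_pairElem]; rfl
    · rw [op_comp, Functor.map_comp_apply, eps₂_pairElem]; rfl
  t_comp_top {i} a b e := by
    refine (Functor.map_comp_apply X (S.nabla _).op (tgt S.functor _).op _).symm.trans ?_
    rw [← op_comp, S.tgt_nabla_top, op_comp, Functor.map_comp_apply, eps₁_pairElem]
    rfl
  t_comp_low {i j} h a b e := by
    refine (Functor.map_comp_apply X (S.nabla _).op (tgt S.functor _).op _).symm.trans ?_
    rw [← op_comp, S.tgt_nabla_low h]
    refine (map_nabla_copair hX h _ _ _ _).trans (compElem_congr hX h ?_ ?_ _)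
    · rw [op_comp, Functor.map_comp_apply, eps₁_pairElem]; rfl
    · rw [op_comp, Functor.map_comp_apply, eps₂_pairElem]; rfl
  s_unit {i} a := by
    refine (Functor.map_comp_apply X (S.kappa i).op (src S.functor _).op a).symm.trans ?_
    rw [← op_comp, S.src_kappa, op_id, Functor.map_id_apply]
  t_unit {i} a := by
    refine (Functor.map_comp_apply X (S.kappa i).op (tgt S.functor _).op a).symm.trans ?_
    rw [← op_comp, S.tgt_kappa, op_id, Functor.map_id_apply]

lemma infPrecat_unitIter {i j : ℕ} (h : j ≤ i) (a : (S.cellsOf X).cell j) :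
    (infPrecat hX).unitIter h a = X.map (S.kappaIter h).op a := by
  induction i, h using Nat.le_induction with
  | base =>
    rw [S.kappaIter_self, op_id, Functor.map_id_apply]
    exact (infPrecat hX).unitIter_self a
  | succ i h ih =>
    refine ((infPrecat hX).unitIter_succ h a).trans ?_
    rw [ih, S.kappaIter_succ, op_comp, Functor.map_comp_apply]
    rfl

lemma isStrict_infPrecat (hS : S.IsCategorical) : (infPrecat hX).IsStrict where
  ass {i j} h a b c e e' := by
    obtain ⟨y, hy, -⟩ := existsUnique_elem S.isGlobular hX (Table.triple h)
      (fun (k : Fin 3) => match k with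
        | 0 => a
        | 1 => b
        | 2 => c)
      (fun (k : Fin 2) => match k with
        | 0 => e
        | 1 => e')
    obtain rfl : X.map (epsTriple S.functor h 0).op y = a := hy (0 : Fin 3)
    obtain rfl : X.map (epsTriple S.functor h 1).op y = b := hy (1 : Fin 3)
    obtain rfl : X.map (epsTriple S.functor h 2).op y = c := hy (2 : Fin 3)
    have := congrArg (fun f => X.map f.op y) (hS.ass h)
    dsimp only at this
    simp only [map_nabla_copair hX] at this
    exact this.symm
  exc {i j k} h h' a a' b b' e₁ e₂ e₃ := by
    obtain ⟨y, hy, -⟩ := existsUnique_elem S.isGlobular hX (Table.quad h h')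
      (fun (k : Fin 4) => match k with
        | 0 => a
        | 1 => a'
        | 2 => b
        | 3 => b')
      (fun (k : Fin 3) => match k with
        | 0 => e₁
        | 1 => e₂
        | 2 => e₃)
    obtain rfl : X.map (epsQuad S.functor h h' 0).op y = a := hy (0 : Fin 4)
    obtain rfl : X.map (epsQuad S.functor h h' 1).op y = a' := hy (1 : Fin 4)
    obtain rfl : X.map (epsQuad S.functor h h' 2).op y = b := hy (2 : Fin 4)
    obtain rfl : X.map (epsQuad S.functor h h' 3).op y = b' := hy (3 : Fin 4)
    have := congrArg (fun f => X.map f.op y) (hS.exc h h')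
    dsimp only at this
    simp only [map_nabla_copair hX] at this
    exact this
  lun {i j} h := fun (a : (S.cellsOf X).cell i) => by
    have := congrArg (fun f => X.map f.op a) (hS.lun h)
    dsimp only at this
    rw [map_nabla_copair hX] at this
    refine Eq.trans ?_ (this.trans (Functor.map_id_apply X _ a))
    refine compElem_congr hX h ?_ ?_ _
    · exact (infPrecat_unitIter hX h.le _).trans (Functor.map_comp_apply X _ _ a).symm
    · exact (Functor.map_id_apply X _ a).symm
  run {i j} h := fun (a : (S.cellsOf X).cell i) => by
    have := congrArg (fun f => X.map f.op a) (hS.run h)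
    dsimp only at this
    rw [map_nabla_copair hX] at this
    refine Eq.trans ?_ (this.trans (Functor.map_id_apply X _ a))
    refine compElem_congr hX h ?_ ?_ _
    · exact (Functor.map_id_apply X _ a).symm
    · exact (infPrecat_unitIter hX h.le _).trans (Functor.map_comp_apply X _ _ a).symm
  func {i j} h := fun (a b : (S.cellsOf X).cell i)
      (e : (S.cellsOf X).s h a = (S.cellsOf X).t h b) => by
    have := congrArg (fun f => X.map f.op (pairElem hX h a b e)) (hS.func h)
    dsimp only at this
    rw [map_nabla_copair hX, op_comp, Functor.map_comp_apply] at this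
    refine this.trans (compElem_congr hX _ ?_ ?_ _)
    · rw [op_comp, Functor.map_comp_apply, eps₁_pairElem]; rfl
    · rw [op_comp, Functor.map_comp_apply, eps₂_pairElem]; rfl

end

end PrecatStructure

namespace CatStructure

variable {C : Type w} [Category.{u} C] (S : CatStructure.{u} C)

/-- The canonical functor from globular presheaves on a categorical globular extension to strict
`∞`-categories. -/
noncomputable def modToInfCat : Mod (globeToTheta0 ⋙ S.functor) ⥤ InfCat.{u} where
  obj X := ⟨PrecatStructure.infPrecat X.property,
    PrecatStructure.isStrict_infPrecat X.property S.isCategorical⟩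
  map {X Y} α := ObjectProperty.homMk
    { app := Functor.whiskerLeft (globeToTheta0 ⋙ S.functor).op α.hom
      app_comp := fun {i j} h (a b : (S.cellsOf X.obj).cell i)
          (e : (S.cellsOf X.obj).s h a = (S.cellsOf X.obj).t h b) => by
        refine (NatTrans.naturality_apply α.hom (S.nabla h).op _).trans ?_
        refine congrArg (Y.obj.map (S.nabla h).op) ?_
        apply PrecatStructure.pairElem_eq
        · rw [← NatTrans.naturality_apply, PrecatStructure.eps₁_pairElem]; rfl
        · rw [← NatTrans.naturality_apply, PrecatStructure.eps₂_pairElem]; rfl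
      app_unit := fun {i} a => NatTrans.naturality_apply α.hom (S.kappa i).op a }
  map_id _ := rfl
  map_comp _ _ := rfl

/-- The functor `C ⥤ Mod(C) ⥤ ∞-Cat` of a categorical globular extension `C`. -/
noncomputable def toInfCat : C ⥤ InfCat.{u} :=
  yonedaMod (globeToTheta0 ⋙ S.functor) ⋙ S.modToInfCat

end CatStructure

/-! ## Globular pasting schemes and free strict `∞`-categories -/

/-- The functor from `Θ₀` to globular sets, `Θ₀ ⥤ Mod(Θ₀) ⥤ GlobularSet`. -/
noncomputable def theta0ToGlobularSet : Theta0.{u} ⥤ GlobularSet.{u} :=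
  yonedaMod globeToTheta0 ⋙ (IsGlobularPresheaf globeToTheta0).ι ⋙
    (Functor.whiskeringLeft _ _ _).obj globeToTheta0.op

/-- Globular pasting schemes: the globular sets in the (essential) image of `Θ₀`. -/
def IsPastingScheme (P : GlobularSet.{u}) : Prop :=
  theta0ToGlobularSet.essImage P

/-- `X` is a free strict `∞`-category on the globular set `P`: there is a morphism from `P` to the
underlying globular set of `X` which is universal. -/
def IsFreeOn (X : InfCat.{u}) (P : GlobularSet.{u}) : Prop :=
  ∃ η : P ⟶ InfCat.forget.obj X, Nonempty (IsInitial (StructuredArrow.mk η))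

end Globular

open Globular

/-!
A categorical globular extension `C` turns each of its objects `X` into a strict `∞`-category,
whose cells are the morphisms from the disks to `X`.  As the globular sum of a table of dimensions
`T` is a colimit, morphisms from it to `X` in `C` are the same as morphisms of globular sets from
the globular sum `T.globularSet` to the cells of `X`
(`PrecatStructure.existsUnique_unitMap`).

Hence everything is formal once the strict `∞`-categories of cells of the globular sums are known to
be free, which is the property `CatStructure.HasFreeCells`: morphisms between the `∞`-categories
of cells of two globular sums are then described by the same data as morphisms between the globular
sums themselves, so `toInfCat` is fully faithful, and its essential image consists of the free
strict `∞`-categories on pasting schemes.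

The universal example is the category `FreeTheta` of free strict `∞`-categories on the globular
sums.  Free strict `∞`-categories exist on any globular set `P`: a cell is a formal composite of
cells of `P` that makes sense in all strict `∞`-categories under `P`, two of them being identified
when they have the same value in all of these.  Disks represent cells in `FreeTheta`, which gives
the operations `nabla` and `kappa` (`FreeTheta.catStructure`) and the freeness of cells
(`FreeTheta.hasFreeCells`).  The universal property holds because a structure of categorical
globular extension `S` on `C` allows one to evaluate the cells of a free strict `∞`-category on a
globular sum among the morphisms of `C` (`FreeTheta.ev`); evaluating the images of the principal
cells defines the functor `FreeTheta ⥤ C` (`FreeTheta.extend`).  It is unique, and natural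
transformations extend along it, because cells of free strict `∞`-categories are generated by
compositions and units (`Free.induction`).

Finally, any universal categorical globular extension is equivalent to `FreeTheta`, compatibly with
the structures (`CatStructure.IsUniversal.exists_equivalence`), so it inherits the freeness of
cells.
-/

namespace Globular

/-! ### Free strict `∞`-categories -/

/-- Formal composites of cells of a globular set.  No compatibility of sources and targets is
required: whether such an expression makes sense is decided by evaluating it. -/
inductive Term (P : GlobularSet.{u}) : ℕ → Type u
  | var {i : ℕ} (x : P.cell i) : Term P i
  | comp {i j : ℕ} (h : j < i) (a b : Term P i) : Term P i
  | unit {i : ℕ} (a : Term P i) : Term P (i + 1)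

/-- `Eval φ t x`: the expression `t` makes sense in `X` when its variables are interpreted by `φ`,
and its value is `x`. -/
inductive Eval {P : GlobularSet.{u}} {X : InfPrecat.{u}} (φ : P ⟶ X.cells) :
    ∀ {i : ℕ}, Term P i → X.cells.cell i → Prop
  | var {i : ℕ} (x : P.cell i) : Eval φ (.var x) (φ.app _ x)
  | comp {i j : ℕ} (h : j < i) {a b : Term P i} {x y : X.cells.cell i} (ha : Eval φ a x)
      (hb : Eval φ b y) (e : X.cells.s h x = X.cells.t h y) :
      Eval φ (.comp h a b) (X.comp h x y e)
  | unit {i : ℕ} {a : Term P i} {x : X.cells.cell i} (ha : Eval φ a x) :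
      Eval φ (.unit a) (X.unit x)

namespace Eval

variable {P : GlobularSet.{u}} {X : InfPrecat.{u}} {φ : P ⟶ X.cells}

lemma exists_of_comp {i j : ℕ} {h : j < i} {a b : Term P i} {z : X.cells.cell i}
    (hz : Eval φ (.comp h a b) z) :
    ∃ (x y : X.cells.cell i) (e : X.cells.s h x = X.cells.t h y),
      Eval φ a x ∧ Eval φ b y ∧ z = X.comp h x y e := by
  cases hz with
  | comp _ ha hb e => exact ⟨_, _, e, ha, hb, rfl⟩

lemma exists_of_unit {i : ℕ} {a : Term P i} {z : X.cells.cell (i + 1)}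
    (hz : Eval φ (.unit a) z) : ∃ x, Eval φ a x ∧ z = X.unit x := by
  cases hz with
  | unit ha => exact ⟨_, ha, rfl⟩

lemma eq_of_var {i : ℕ} {p : P.cell i} {z : X.cells.cell i}
    (hz : Eval φ (.var p) z) : z = φ.app _ p := by
  cases hz with
  | var => rfl

lemma congr {i : ℕ} {t : Term P i} {x y : X.cells.cell i} (hx : Eval φ t x) (e : y = x) :
    Eval φ t y :=
  e ▸ hx

lemma unique {i : ℕ} {t : Term P i} {x y : X.cells.cell i} (hx : Eval φ t x) (hy : Eval φ t y) :
    x = y := by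
  induction hx with
  | var p => exact hy.eq_of_var.symm
  | comp h _ _ e iha ihb =>
    obtain ⟨x', y', e', ha, hb, rfl⟩ := hy.exists_of_comp
    exact X.comp_congr h (iha ha) (ihb hb) e
  | unit _ ih =>
    obtain ⟨x', ha, rfl⟩ := hy.exists_of_unit
    rw [ih ha]

end Eval

/-- Faces of expressions: the sources and targets of the value of an expression are the values of
expressions which depend on the given expression only. -/
lemma Term.exists_face {P : GlobularSet.{u}} {i : ℕ} (t : Term P i) {a : Globe.{u}}
    (f : a ⟶ D i) :
    ∃ t' : Term P a.dim, ∀ (X : InfPrecat.{u}) (φ : P ⟶ X.cells) (x : X.cells.cell i),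
      Eval φ t x → Eval φ t' (X.cells.map f.op x) := by
  induction t with
  | @var i p =>
    refine ⟨.var (P.map f.op p), fun X φ x hx => ?_⟩
    obtain rfl := hx.eq_of_var
    rw [← NatTrans.naturality_apply]
    exact .var _
  | @comp i j h t₁ t₂ ih₁ ih₂ =>
    obtain ⟨t₁', h₁⟩ := ih₁ f
    obtain ⟨t₂', h₂⟩ := ih₂ f
    have hid : ∀ (X : InfPrecat.{u}) (x : X.cells.cell i), X.cells.map (𝟙 (D i)).op x = x :=
      fun X x => Functor.map_id_apply X.cells _ x
    change Globe.Hom a (D _) at f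
    cases f with
    | id =>
      refine ⟨.comp h t₁ t₂, fun X φ x hx => ?_⟩
      erw [hid]
      exact hx
    | src hk =>
      obtain hlt | heq | hgt := lt_trichotomy j a.dim
      · refine ⟨.comp hlt t₁' t₂', fun X φ z hz => ?_⟩
        obtain ⟨x, y, e, hx, hy, rfl⟩ := hz.exists_of_comp
        have := X.s_comp_of_lt hk hlt x y e
        exact (Eval.comp hlt (h₁ X φ x hx) (h₂ X φ y hy) _).congr this
      · refine ⟨t₂', fun X φ z hz => ?_⟩
        obtain ⟨x, y, e, hx, hy, rfl⟩ := hz.exists_of_comp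
        obtain ⟨k⟩ := a
        obtain rfl : j = k := heq
        have := X.s_comp_self h x y e
        exact (h₂ X φ y hy).congr this
      · refine ⟨t₂', fun X φ z hz => ?_⟩
        obtain ⟨x, y, e, hx, hy, rfl⟩ := hz.exists_of_comp
        have := X.s_comp_lower h x y e hgt
        exact (h₂ X φ y hy).congr this
    | tgt hk =>
      obtain hlt | heq | hgt := lt_trichotomy j a.dim
      · refine ⟨.comp hlt t₁' t₂', fun X φ z hz => ?_⟩
        obtain ⟨x, y, e, hx, hy, rfl⟩ := hz.exists_of_comp
        have := X.t_comp_of_lt hk hlt x y e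
        exact (Eval.comp hlt (h₁ X φ x hx) (h₂ X φ y hy) _).congr this
      · refine ⟨t₁', fun X φ z hz => ?_⟩
        obtain ⟨x, y, e, hx, hy, rfl⟩ := hz.exists_of_comp
        obtain ⟨k⟩ := a
        obtain rfl : j = k := heq
        have := X.t_comp_self h x y e
        exact (h₁ X φ x hx).congr this
      · refine ⟨t₁', fun X φ z hz => ?_⟩
        obtain ⟨x, y, e, hx, hy, rfl⟩ := hz.exists_of_comp
        have := X.t_comp_lower h x y e hgt
        exact (h₁ X φ x hx).congr this
  | @unit i t ih =>
    change Globe.Hom a (D _) at f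
    cases f with
    | id =>
      refine ⟨.unit t, fun X φ x hx => ?_⟩
      have : X.cells.map (𝟙 (D (i + 1))).op x = x := Functor.map_id_apply X.cells _ x
      exact this.symm ▸ hx
    | src hk =>
      obtain hlt | heq := Nat.lt_succ_iff_lt_or_eq.1 hk
      · obtain ⟨t', h'⟩ := ih (Globe.Hom.src hlt : a ⟶ D i)
        refine ⟨t', fun X φ z hz => ?_⟩
        obtain ⟨x, hx, rfl⟩ := hz.exists_of_unit
        have := X.cells.s_s i.lt_succ_self hlt (X.unit x)
        rw [X.s_unit] at this
        exact (h' X φ x hx).congr this.symm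
      · obtain ⟨k⟩ := a
        obtain rfl : k = i := heq
        refine ⟨t, fun X φ z hz => ?_⟩
        obtain ⟨x, hx, rfl⟩ := hz.exists_of_unit
        exact hx.congr (X.s_unit x)
    | tgt hk =>
      obtain hlt | heq := Nat.lt_succ_iff_lt_or_eq.1 hk
      · obtain ⟨t', h'⟩ := ih (Globe.Hom.tgt hlt : a ⟶ D i)
        refine ⟨t', fun X φ z hz => ?_⟩
        obtain ⟨x, hx, rfl⟩ := hz.exists_of_unit
        have := X.cells.t_t i.lt_succ_self hlt (X.unit x)
        rw [X.t_unit] at this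
        exact (h' X φ x hx).congr this.symm
      · obtain ⟨k⟩ := a
        obtain rfl : k = i := heq
        refine ⟨t, fun X φ z hz => ?_⟩
        obtain ⟨x, hx, rfl⟩ := hz.exists_of_unit
        exact hx.congr (X.t_unit x)

namespace Free

variable (P : GlobularSet.{u})

/-- Families of `i`-cells, one in each strict `∞`-category `X` equipped with a morphism from `P`. -/
abbrev Family (i : ℕ) : Type (u + 1) :=
  ∀ (X : InfCat.{u}) (_ : P ⟶ X.obj.cells), X.obj.cells.cell i

variable {P}

/-- A family of cells is represented by an expression if it consists of the values of this
expression. -/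
def Represents {i : ℕ} (t : Term P i) (v : Family P i) : Prop :=
  ∀ (X : InfCat.{u}) (φ : P ⟶ X.obj.cells), Eval φ t (v X φ)

variable (P) in
/-- The cells of the free strict `∞`-category on `P`, in the universe `u + 1`: the families of
cells represented by an expression. -/
abbrev BigCell (i : ℕ) : Type (u + 1) := {v : Family P i // ∃ t : Term P i, Represents t v}

-- A family of cells is determined by any expression which represents it.
instance (i : ℕ) : Small.{u} (BigCell P i) := by
  refine small_of_injective (β := Term P i) (f := fun v => v.2.choose) (fun v w hvw => ?_)
  refine Subtype.ext (funext fun X => funext fun φ => ?_)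
  have hw := w.2.choose_spec X φ
  exact (v.2.choose_spec X φ).unique ((show v.2.choose = w.2.choose from hvw) ▸ hw)

variable (P) in
/-- The cells of the free strict `∞`-category on `P`. -/
def Cell (i : ℕ) : Type u := Shrink.{u} (BigCell P i)

/-- The value of a cell of the free strict `∞`-category on `P`. -/
noncomputable def Cell.val {i : ℕ} (c : Cell P i) : Family P i := ((equivShrink _).symm c).1

lemma Cell.exists_represents {i : ℕ} (c : Cell P i) : ∃ t : Term P i, Represents t c.val :=
  ((equivShrink _).symm c).2

/-- The cell of the free strict `∞`-category on `P` with given values. -/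
noncomputable def Cell.mk {i : ℕ} (v : Family P i) (hv : ∃ t : Term P i, Represents t v) :
    Cell P i :=
  equivShrink _ ⟨v, hv⟩

@[simp]
lemma Cell.val_mk {i : ℕ} (v : Family P i) (hv : ∃ t : Term P i, Represents t v) :
    (Cell.mk v hv).val = v := by
  simp [Cell.mk, Cell.val]

lemma Cell.ext {i : ℕ} {c d : Cell P i} (h : ∀ X φ, c.val X φ = d.val X φ) : c = d :=
  (equivShrink _).symm.injective (Subtype.ext (funext fun X => funext fun φ => h X φ))

variable (P) in
/-- The underlying globular set of the free strict `∞`-category on `P`. -/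
noncomputable def cells : GlobularSet.{u} where
  obj a := Cell P a.unop.dim
  map {a b} f := ↾fun c => Cell.mk (fun X φ => X.obj.cells.map f (c.val X φ)) (by
    obtain ⟨t, ht⟩ := c.exists_represents
    obtain ⟨t', ht'⟩ := t.exists_face f.unop
    exact ⟨t', fun X φ => ht' X.obj φ _ (ht X φ)⟩)
  map_id a := by
    ext c
    refine Cell.ext fun X φ => ?_
    simp
  map_comp f g := by
    ext c
    refine Cell.ext fun X φ => ?_
    simp

/-- The value of a cell, at a strict `∞`-category `X` and a morphism `P ⟶ X`. -/
noncomputable abbrev val {i : ℕ} (c : (cells P).cell i) (X : InfCat.{u})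
    (φ : P ⟶ X.obj.cells) : X.obj.cells.cell i :=
  Cell.val c X φ

lemma val_map {a b : Globe.{u}ᵒᵖ} (f : a ⟶ b) (c : (cells P).obj a) (X : InfCat.{u})
    (φ : P ⟶ X.obj.cells) :
    val ((cells P).map f c) X φ = X.obj.cells.map f (val c X φ) := by
  refine (congrFun (congrFun (Cell.val_mk _ _) X) φ)

lemma val_compat {i j : ℕ} {h : j < i} {a b : (cells P).cell i}
    (e : (cells P).s h a = (cells P).t h b) (X : InfCat.{u}) (φ : P ⟶ X.obj.cells) :
    X.obj.cells.s h (val a X φ) = X.obj.cells.t h (val b X φ) :=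
  (val_map _ a X φ).symm.trans ((congrArg (fun c => Cell.val c X φ) e).trans (val_map _ b X φ))

/-- Composition of cells, computed in each strict `∞`-category under `P`. -/
noncomputable def comp {i j : ℕ} (h : j < i) (a b : (cells P).cell i)
    (e : (cells P).s h a = (cells P).t h b) : (cells P).cell i :=
  Cell.mk (fun X φ => X.obj.comp h (val a X φ) (val b X φ) (val_compat e X φ)) (by
    obtain ⟨t, ht⟩ := Cell.exists_represents a
    obtain ⟨t', ht'⟩ := Cell.exists_represents b
    exact ⟨.comp h t t', fun X φ => .comp h (ht X φ) (ht' X φ) _⟩)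

/-- Units of cells, computed in each strict `∞`-category under `P`. -/
noncomputable def unit {i : ℕ} (a : (cells P).cell i) : (cells P).cell (i + 1) :=
  Cell.mk (fun X φ => X.obj.unit (val a X φ)) (by
    obtain ⟨t, ht⟩ := Cell.exists_represents a
    exact ⟨.unit t, fun X φ => .unit (ht X φ)⟩)

@[simp]
lemma val_comp {i j : ℕ} (h : j < i) (a b : (cells P).cell i)
    (e : (cells P).s h a = (cells P).t h b) (X : InfCat.{u}) (φ : P ⟶ X.obj.cells) :
    val (comp h a b e) X φ = X.obj.comp h (val a X φ) (val b X φ) (val_compat e X φ) :=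
  congrFun (congrFun (Cell.val_mk _ _) X) φ

@[simp]
lemma val_unit {i : ℕ} (a : (cells P).cell i) (X : InfCat.{u}) (φ : P ⟶ X.obj.cells) :
    val (unit a) X φ = X.obj.unit (val a X φ) :=
  congrFun (congrFun (Cell.val_mk _ _) X) φ

lemma val_s {i j : ℕ} (h : j < i) (c : (cells P).cell i) (X : InfCat.{u})
    (φ : P ⟶ X.obj.cells) : val ((cells P).s h c) X φ = X.obj.cells.s h (val c X φ) :=
  val_map _ c X φ

lemma val_t {i j : ℕ} (h : j < i) (c : (cells P).cell i) (X : InfCat.{u})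
    (φ : P ⟶ X.obj.cells) : val ((cells P).t h c) X φ = X.obj.cells.t h (val c X φ) :=
  val_map _ c X φ

lemma cell_ext {i : ℕ} {c d : (cells P).cell i} (h : ∀ X φ, val c X φ = val d X φ) : c = d :=
  Cell.ext h

variable (P) in
/-- The free strict `∞`-category on `P`, as an `∞`-precategory. -/
noncomputable abbrev precat : InfPrecat.{u} where
  cells := cells P
  comp := comp
  unit := unit
  s_comp_top a b e := cell_ext fun X φ => by
    rw [val_s, val_comp, X.obj.s_comp_top, val_s]
  s_comp_low h a b e := cell_ext fun X φ => by
    rw [val_s, val_comp, X.obj.s_comp_low h, val_comp]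
    exact X.obj.comp_congr h (val_s _ a X φ).symm (val_s _ b X φ).symm _
  t_comp_top a b e := cell_ext fun X φ => by
    rw [val_t, val_comp, X.obj.t_comp_top, val_t]
  t_comp_low h a b e := cell_ext fun X φ => by
    rw [val_t, val_comp, X.obj.t_comp_low h, val_comp]
    exact X.obj.comp_congr h (val_t _ a X φ).symm (val_t _ b X φ).symm _
  s_unit a := cell_ext fun X φ => by rw [val_s, val_unit, X.obj.s_unit]
  t_unit a := cell_ext fun X φ => by rw [val_t, val_unit, X.obj.t_unit]

lemma val_unitIter {i j : ℕ} (h : j ≤ i) (a : (cells P).cell j) (X : InfCat.{u})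
    (φ : P ⟶ X.obj.cells) :
    val ((precat P).unitIter h a) X φ = X.obj.unitIter h (val a X φ) := by
  induction i, h using Nat.le_induction with
  | base =>
    exact (congrArg (fun c => Cell.val c X φ) ((precat P).unitIter_self a)).trans
      (X.obj.unitIter_self _).symm
  | succ i h ih =>
    refine (congrArg (fun c => Cell.val c X φ) ((precat P).unitIter_succ h a)).trans ?_
    exact (val_unit _ X φ).trans ((congrArg X.obj.unit ih).trans (X.obj.unitIter_succ h _).symm)

lemma val_precat_comp {i j : ℕ} (h : j < i) (a b : (precat P).cells.cell i)
    (e : (precat P).cells.s h a = (precat P).cells.t h b) (X : InfCat.{u})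
    (φ : P ⟶ X.obj.cells) : val ((precat P).comp h a b e) X φ =
      X.obj.comp h (val a X φ) (val b X φ) (val_compat e X φ) :=
  val_comp h a b e X φ

lemma isStrict : (precat P).IsStrict where
  ass h a b c e e' := cell_ext fun X φ => by
    refine (val_precat_comp h _ c _ X φ).trans (Eq.trans ?_ (val_precat_comp h a _ _ X φ).symm)
    refine (X.obj.comp_congr h (val_precat_comp h a b e X φ) rfl _).trans ?_
    refine (X.property.ass h _ _ _ _ (val_compat e' X φ)).trans ?_
    exact (X.obj.comp_congr h rfl (val_precat_comp h b c e' X φ).symm _)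
  exc {i j k} h h' a a' b b' e₁ e₂ e₃ := cell_ext fun X φ => by
    refine (val_precat_comp _ _ _ _ X φ).trans (Eq.trans ?_ (val_precat_comp _ _ _ _ X φ).symm)
    refine (X.obj.comp_congr _ (val_precat_comp h a a' e₁ X φ)
      (val_precat_comp h b b' e₃ X φ) _).trans ?_
    refine (X.property.exc h h' _ _ _ _ _ (val_compat e₂ X φ) _).trans ?_
    exact X.obj.comp_congr h (val_precat_comp _ _ _ _ X φ).symm
      (val_precat_comp _ _ _ _ X φ).symm _
  lun h a := cell_ext fun X φ => by
    refine (val_precat_comp _ _ _ _ X φ).trans ?_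
    refine Eq.trans (X.obj.comp_congr h ?_ rfl _) (X.property.lun h _)
    exact (val_unitIter _ _ X φ).trans (congrArg _ (val_t h a X φ))
  run h a := cell_ext fun X φ => by
    refine (val_precat_comp _ _ _ _ X φ).trans ?_
    refine Eq.trans (X.obj.comp_congr h rfl ?_ _) (X.property.run h _)
    exact (val_unitIter _ _ X φ).trans (congrArg _ (val_s h a X φ))
  func h a b e := cell_ext fun X φ => by
    refine (val_unit _ X φ).trans (Eq.trans ?_ (val_precat_comp _ _ _ _ X φ).symm)
    refine (congrArg X.obj.unit (val_precat_comp h a b e X φ)).trans ?_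
    refine (X.property.func h _ _ _).trans ?_
    exact X.obj.comp_congr _ (val_unit _ X φ).symm (val_unit _ X φ).symm _

end Free

/-- The free strict `∞`-category on a globular set. -/
noncomputable abbrev free (P : GlobularSet.{u}) : InfCat.{u} := ⟨Free.precat P, Free.isStrict⟩

namespace Free

variable {P : GlobularSet.{u}}

/-- A cell of `P`, as a cell of the free strict `∞`-category on `P`. -/
noncomputable def gen {i : ℕ} (x : P.cell i) : (cells P).cell i :=
  Cell.mk (fun _ φ => φ.app _ x) ⟨.var x, fun _ _ => .var x⟩

lemma val_gen {i : ℕ} (x : P.cell i) (X : InfCat.{u}) (φ : P ⟶ X.obj.cells) :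
    val (gen x) X φ = φ.app _ x :=
  congrFun (congrFun (Cell.val_mk _ _) X) φ

variable (P) in
/-- The canonical morphism from a globular set to the free strict `∞`-category on it. -/
noncomputable def η : P ⟶ (free P).obj.cells where
  app a := ↾fun x => gen x
  naturality a b f := by
    ext x
    refine cell_ext fun X φ => ?_
    refine (val_gen _ X φ).trans (Eq.trans ?_ (val_map f _ X φ).symm)
    exact (NatTrans.naturality_apply φ f x).trans
      (congrArg (X.obj.cells.map f) (val_gen x X φ).symm)

/-- The extension of a morphism from `P` to a strict `∞`-category to the free strict `∞`-category
on `P`: evaluation. -/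
noncomputable def lift {X : InfCat.{u}} (φ : P ⟶ X.obj.cells) : free P ⟶ X :=
  ObjectProperty.homMk
    { app :=
        { app := fun _ => ↾fun c => Cell.val c X φ
          naturality := fun a b f => by
            ext c
            exact val_map f c X φ }
      app_comp := fun h a b e => val_comp h a b e X φ
      app_unit := fun a => val_unit a X φ }

@[simp]
lemma η_lift {X : InfCat.{u}} (φ : P ⟶ X.obj.cells) : η P ≫ (lift φ).hom.app = φ := by
  ext a x
  exact val_gen x X φ

/-- The cells of the free strict `∞`-category on `P` are generated by those of `P`. -/
lemma induction {motive : ∀ {i : ℕ}, (free P).obj.cells.cell i → Prop}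
    (var : ∀ {i : ℕ} (x : P.cell i), motive (i := i) ((η P).app _ x))
    (comp : ∀ {i j : ℕ} (h : j < i) (a b : (free P).obj.cells.cell i)
      (e : (free P).obj.cells.s h a = (free P).obj.cells.t h b), motive a → motive b →
      motive ((free P).obj.comp h a b e))
    (unit : ∀ {i : ℕ} (a : (free P).obj.cells.cell i), motive a → motive ((free P).obj.unit a))
    {i : ℕ} (c : (free P).obj.cells.cell i) : motive c := by
  suffices ∀ {i : ℕ} (t : Term P i) (c : (free P).obj.cells.cell i),
      Represents t (Cell.val c) → motive c from
    (Cell.exists_represents c).elim fun t ht => this t c ht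
  intro i t c ht
  have hmk : ∀ {i : ℕ} (v : Family P i) (hv : ∃ t, Represents t v) X φ,
      val (Cell.mk v hv) X φ = v X φ := fun v hv X φ => congrFun (congrFun (Cell.val_mk v hv) X) φ
  induction t with
  | var x =>
    obtain rfl : c = (η P).app _ x := cell_ext fun X φ =>
      (ht X φ).eq_of_var.trans (val_gen x X φ).symm
    exact var x
  | comp h t t' ih ih' =>
    -- The values of the two subexpressions form cells of the free `∞`-category themselves.
    choose v v' e hv hv' hc using fun X φ => (ht X φ).exists_of_comp
    have E : (cells P).s h (Cell.mk v ⟨t, hv⟩) = (cells P).t h (Cell.mk v' ⟨t', hv'⟩) :=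
      cell_ext fun X φ => by
        refine (val_s h _ X φ).trans (Eq.trans ?_ (val_t h _ X φ).symm)
        exact (congrArg _ (hmk _ _ X φ)).trans ((e X φ).trans (congrArg _ (hmk _ _ X φ).symm))
    obtain rfl : c = Free.comp h _ _ E := cell_ext fun X φ => by
      refine (hc X φ).trans (Eq.trans ?_ (val_comp _ _ _ _ X φ).symm)
      exact X.obj.comp_congr h (hmk _ _ X φ).symm (hmk _ _ X φ).symm _
    exact comp h _ _ E (ih _ (by rw [Cell.val_mk]; exact hv))
      (ih' _ (by rw [Cell.val_mk]; exact hv'))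
  | unit t ih =>
    choose v hv hc using fun X φ => (ht X φ).exists_of_unit
    obtain rfl : c = Free.unit (Cell.mk v ⟨t, hv⟩) := cell_ext fun X φ =>
      (hc X φ).trans (Eq.trans (congrArg _ (hmk _ _ X φ).symm) (val_unit _ X φ).symm)
    exact unit _ (ih _ (by rw [Cell.val_mk]; exact hv))

lemma hom_ext {X : InfCat.{u}} {f g : free P ⟶ X}
    (h : η P ≫ f.hom.app = η P ≫ g.hom.app) : f = g := by
  have key : ∀ {i : ℕ} (c : (free P).obj.cells.cell i), f.hom.app.app _ c = g.hom.app.app _ c := by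
    intro i c
    induction c using Free.induction with
    | var x => exact congrArg (fun φ : P ⟶ X.obj.cells => φ.app _ x) h
    | comp h a b e ha hb =>
      rw [f.hom.app_comp, g.hom.app_comp]
      exact X.obj.comp_congr h ha hb _
    | unit a ha => rw [f.hom.app_unit, g.hom.app_unit, ha]
  refine ObjectProperty.hom_ext _ (InfPrecat.Hom.ext ?_)
  ext a c
  exact key c

end Free

/-! ### Cells of the objects of a globular extension -/

namespace Table

variable {T : Table}

/-- The morphism of `Θ₀` from a disk corresponding to a cell of a globular sum. -/
noncomputable def elem {a : Globe.{u}} (x : T.globularSet.obj (op a)) :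
    globeToTheta0.obj a ⟶ T.obj :=
  InducedCategory.homMk (descSingle a.dim (yonedaEquiv.symm x))

lemma legSingle_elem {a : Globe.{u}} (x : T.globularSet.obj (op a)) :
    legSingle a.dim ≫ (elem x).hom = yonedaEquiv.symm x :=
  legSingle_descSingle _ _

lemma elem_eq {a : Globe.{u}} {x : T.globularSet.obj (op a)}
    {f : globeToTheta0.obj a ⟶ T.obj} (h : legSingle a.dim ≫ f.hom = yonedaEquiv.symm x) :
    elem x = f := by
  apply InducedCategory.hom_ext
  exact single_hom_ext ((legSingle_elem x).trans h.symm)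

lemma elem_map {a b : Globe.{u}} (f : a ⟶ b) (x : T.globularSet.obj (op b)) :
    elem (T.globularSet.map f.op x) = globeToTheta0.map f ≫ elem x := by
  apply elem_eq
  have h₁ := congrArg (fun g => g ≫ (elem x).hom) (legSingle_globeToTheta0 f)
  refine (Category.assoc _ _ _).symm.trans (h₁.trans ?_)
  refine (Category.assoc _ _ _).trans ?_
  refine (congrArg (fun g => yoneda.map f ≫ g) (legSingle_elem x)).trans ?_
  exact (yonedaEquiv_symm_map f.op x).symm

lemma elem_comp {T' : Table} {a : Globe.{u}} (x : T.globularSet.obj (op a))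
    (f : T.obj ⟶ T'.obj) : elem (f.hom.app _ x) = elem x ≫ f := by
  apply elem_eq
  have h₁ := congrArg (fun g => g ≫ f.hom) (legSingle_elem x)
  refine (Category.assoc _ _ _).symm.trans (h₁.trans ?_)
  apply yonedaEquiv.injective
  rw [yonedaEquiv_comp, Equiv.apply_symm_apply, Equiv.apply_symm_apply]

/-- The principal cells of a globular sum: the top cells of the disks it is made of. -/
noncomputable def top (T : Table) (k : Fin (T.n + 1)) :
    GlobularSet.cell.{u} T.globularSet (T.dim k) :=
  yonedaEquiv (T.leg k)

lemma elem_top (T : Table) (k : Fin (T.n + 1)) : elem (T.top k) = T.incl.{u} k := by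
  apply elem_eq
  refine (legSingle_incl T k).trans ?_
  apply yonedaEquiv.injective
  rw [Equiv.apply_symm_apply]
  rfl

lemma top_condition (T : Table) (k : Fin T.n) :
    GlobularSet.s.{u} T.globularSet (T.gap_lt_left k) (T.top k.castSucc) =
      GlobularSet.t.{u} T.globularSet (T.gap_lt_right k) (T.top k.succ) := by
  have h := congrArg (fun f => yonedaEquiv f) (T.leg_condition.{u} k)
  exact (yonedaEquiv_naturality _ _).trans (h.trans (yonedaEquiv_naturality _ _).symm)

lemma globularSet_hom_ext {X : GlobularSet.{u}} {f g : T.globularSet ⟶ X}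
    (h : ∀ k, f.app _ (T.top k) = g.app _ (T.top k)) : f = g :=
  Multicoequalizer.hom_ext _ _ _ fun k => yonedaEquiv.injective (h k)

/-- The morphism from a globular sum to a globular set given by the images of the principal
cells. -/
noncomputable def descCells {X : GlobularSet.{u}} (x : ∀ k : Fin (T.n + 1), X.cell (T.dim k))
    (hx : ∀ k : Fin T.n, X.s (T.gap_lt_left k) (x k.castSucc) =
      X.t (T.gap_lt_right k) (x k.succ)) : T.globularSet ⟶ X :=
  Multicoequalizer.desc (T.index (yoneda (C := Globe.{u}))) X
    (fun k => yonedaEquiv.symm (x k)) (fun k => by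
      refine (yonedaEquiv_symm_map (sigma (T.gap_lt_left k)).op (x k.castSucc)).symm.trans
        (Eq.trans ?_ (yonedaEquiv_symm_map (tau (T.gap_lt_right k)).op (x k.succ)))
      exact congrArg _ (hx k))

lemma descCells_top {X : GlobularSet.{u}} (x : ∀ k : Fin (T.n + 1), X.cell (T.dim k))
    (hx : ∀ k : Fin T.n, X.s (T.gap_lt_left k) (x k.castSucc) =
      X.t (T.gap_lt_right k) (x k.succ)) (k : Fin (T.n + 1)) :
    (descCells x hx).app _ (T.top k) = x k := by
  have h : T.leg k ≫ descCells x hx = yonedaEquiv.symm (x k) :=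
    Multicoequalizer.π_desc _ _ _ _ _
  have := congrArg yonedaEquiv h
  rw [Equiv.apply_symm_apply] at this
  exact this

end Table

namespace PrecatStructure

variable {C : Type w} [Category.{u} C] (S : PrecatStructure.{u} C)

/-- The canonical morphism from a globular sum of globular sets to the globular set of cells of the
corresponding globular sum in `C`. -/
noncomputable def unitMap (T : Table) :
    T.globularSet ⟶ S.cellsOf (yoneda.obj (S.functor.obj T.obj)) where
  app a := ↾fun x => S.functor.map (Table.elem x)
  naturality a b f := by
    ext x
    exact (congrArg S.functor.map (Table.elem_map f.unop x)).trans (S.functor.map_comp _ _)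

lemma unitMap_top (T : Table) (k : Fin (T.n + 1)) :
    (S.unitMap T).app _ (T.top k) = eps S.functor T k :=
  congrArg S.functor.map (T.elem_top k)

/-- The morphism between globular sets of cells induced by a morphism of `C`. -/
noncomputable abbrev cellsMap {X Y : C} (f : X ⟶ Y) :
    S.cellsOf (yoneda.obj X) ⟶ S.cellsOf (yoneda.obj Y) :=
  Functor.whiskerLeft _ (yoneda.map f)

lemma unitMap_naturality {T T' : Table} (f : T.obj ⟶ T'.obj) :
    f.hom ≫ S.unitMap T' = S.unitMap T ≫ S.cellsMap (S.functor.map f) := by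
  ext a x
  exact (congrArg S.functor.map (Table.elem_comp x f)).trans (S.functor.map_comp _ _)

/-- Globular sums of `C` represent morphisms from globular sums of globular sets to the globular
sets of cells. -/
lemma existsUnique_unitMap {T : Table} {X : C}
    (φ : T.globularSet ⟶ S.cellsOf (yoneda.obj X)) :
    ∃! f : S.functor.obj T.obj ⟶ X, S.unitMap T ≫ S.cellsMap f = φ := by
  have key : ∀ f : S.functor.obj T.obj ⟶ X, S.unitMap T ≫ S.cellsMap f = φ ↔
      ∀ k, eps S.functor T k ≫ f = φ.app _ (T.top k) := by
    intro f
    refine ⟨?_, fun h => Table.globularSet_hom_ext fun k => ?_⟩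
    · rintro rfl k
      exact (congrArg (· ≫ f) (S.unitMap_top T k)).symm
    · exact (congrArg (· ≫ f) (S.unitMap_top T k)).trans (h k)
  refine ⟨S.isGlobular.desc T (fun k => φ.app _ (T.top k)) (fun k => ?_), ?_, ?_⟩
  · have h := congrArg (φ.app _) (T.top_condition k)
    rw [GlobularSet.s, GlobularSet.t, NatTrans.naturality_apply, NatTrans.naturality_apply] at h
    exact h
  · exact (key _).2 fun k => S.isGlobular.eps_desc T _ _ k
  · intro f hf
    refine S.isGlobular.hom_ext T fun k => ?_
    rw [(key f).1 hf, S.isGlobular.eps_desc]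

end PrecatStructure

/-! ### Universal morphisms to strict `∞`-categories -/

/-- A morphism from a globular set to a strict `∞`-category is universal if every such morphism
factors uniquely through it. -/
def IsUniversalMap {P : GlobularSet.{u}} {X : InfCat.{u}} (η : P ⟶ X.obj.cells) : Prop :=
  ∀ (Y : InfCat.{u}) (φ : P ⟶ Y.obj.cells), ∃! f : X ⟶ Y, η ≫ f.hom.app = φ

lemma Free.isUniversalMap (P : GlobularSet.{u}) : IsUniversalMap (X := free P) (Free.η P) :=
  fun _ φ => ⟨Free.lift φ, Free.η_lift φ, fun _ hf => Free.hom_ext (hf.trans (Free.η_lift φ).symm)⟩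

namespace IsUniversalMap

lemma isFreeOn {P : GlobularSet.{u}} {X : InfCat.{u}} {η : P ⟶ X.obj.cells}
    (hη : IsUniversalMap η) : IsFreeOn X P :=
  ⟨η, ⟨IsInitial.ofUniqueHom
    (fun A => StructuredArrow.homMk (hη A.right A.hom).choose (hη A.right A.hom).choose_spec.1)
    (fun A m => StructuredArrow.hom_ext _ _
      ((hη A.right A.hom).choose_spec.2 m.right (StructuredArrow.w m)))⟩⟩

end IsUniversalMap

lemma isFreeOn_iff {P : GlobularSet.{u}} {X : InfCat.{u}} :
    IsFreeOn X P ↔ ∃ η : P ⟶ X.obj.cells, IsUniversalMap η := by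
  refine ⟨?_, fun ⟨η, hη⟩ => hη.isFreeOn⟩
  rintro ⟨η, ⟨h⟩⟩
  refine ⟨η, fun Y φ => ?_⟩
  let A : StructuredArrow P InfCat.forget := StructuredArrow.mk (Y := X) η
  let B : StructuredArrow P InfCat.forget := StructuredArrow.mk (Y := Y) φ
  refine ⟨(h.to B).right, StructuredArrow.w (h.to B), fun f hf => ?_⟩
  have : StructuredArrow.homMk (f := A) (f' := B) f hf = h.to B := h.hom_ext _ _
  exact congrArg CommaMorphism.right this

namespace IsUniversalMap

variable {P : GlobularSet.{u}} {X Y : InfCat.{u}} {η : P ⟶ X.obj.cells}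

lemma hom_ext (hη : IsUniversalMap η) {f g : X ⟶ Y}
    (h : η ≫ f.hom.app = η ≫ g.hom.app) : f = g :=
  (hη Y _).unique h rfl

lemma comp_iso (hη : IsUniversalMap η) (e : X ≅ Y) : IsUniversalMap (η ≫ e.hom.hom.app) := by
  intro Z φ
  obtain ⟨f, hf, hf'⟩ := hη Z φ
  have h₁ : e.hom.hom.app ≫ e.inv.hom.app = 𝟙 _ :=
    congrArg (fun g : X ⟶ X => g.hom.app) e.hom_inv_id
  refine ⟨e.inv ≫ f, ?_, fun g hg => ?_⟩
  · change (η ≫ e.hom.hom.app) ≫ e.inv.hom.app ≫ f.hom.app = φ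
    rw [Category.assoc, reassoc_of% h₁, hf]
  · rw [Iso.eq_inv_comp]
    exact hf' _ (by rw [← hg, Category.assoc]; rfl)

lemma iso_comp (hη : IsUniversalMap η) {Q : GlobularSet.{u}} (e : Q ≅ P) :
    IsUniversalMap (e.hom ≫ η) := by
  intro Z φ
  obtain ⟨f, hf, hf'⟩ := hη Z (e.inv ≫ φ)
  refine ⟨f, ?_, fun g hg => hf' g ?_⟩
  · dsimp only
    rw [Category.assoc, hf, e.hom_inv_id_assoc]
  · dsimp only at hg ⊢
    rw [← hg, Category.assoc, e.inv_hom_id_assoc]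

lemma of_comp_iso (e : X ≅ Y) (h : IsUniversalMap (η ≫ e.hom.hom.app)) : IsUniversalMap η := by
  have h₁ : e.hom.hom.app ≫ e.inv.hom.app = 𝟙 _ :=
    congrArg (fun g : X ⟶ X => g.hom.app) e.hom_inv_id
  have h₂ := h.comp_iso e.symm
  rw [Iso.symm_hom, Category.assoc, h₁, Category.comp_id] at h₂
  exact h₂

/-- Free strict `∞`-categories on the same globular set are isomorphic. -/
lemma nonempty_iso (hη : IsUniversalMap η) {η' : P ⟶ Y.obj.cells} (hη' : IsUniversalMap η') :
    Nonempty (X ≅ Y) := by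
  obtain ⟨f, hf, -⟩ := hη Y η'
  obtain ⟨g, hg, -⟩ := hη' X η
  refine ⟨⟨f, g, hη.hom_ext ?_, hη'.hom_ext ?_⟩⟩
  · change η ≫ f.hom.app ≫ g.hom.app = η ≫ 𝟙 _
    rw [reassoc_of% hf, hg, Category.comp_id]
  · change η' ≫ g.hom.app ≫ f.hom.app = η' ≫ 𝟙 _
    rw [reassoc_of% hg, hf, Category.comp_id]

end IsUniversalMap

/-- A morphism of strict `∞`-categories which is bijective on cells is an isomorphism. -/
lemma InfCat.isIso_of_bijective {X Y : InfCat.{u}} (f : X ⟶ Y)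
    (hf : ∀ i : ℕ, Function.Bijective (f.hom.app.app (op (D i)))) : IsIso f := by
  have : ∀ a, IsIso (f.hom.app.app a) := fun a => (isIso_iff_bijective _).2 (hf a.unop.dim)
  have : IsIso f.hom.app := NatIso.isIso_of_isIso_app _
  have hg : ∀ {a : Globe.{u}ᵒᵖ} (y : Y.obj.cells.obj a),
      f.hom.app.app a ((inv f.hom.app).app a y) = y := fun y => by
    rw [← NatTrans.comp_app_apply, IsIso.inv_hom_id]
    rfl
  let g : Y ⟶ X := ObjectProperty.homMk
    { app := inv f.hom.app
      app_comp := fun {i j} h a b e => (hf i).1 (by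
        rw [hg, f.hom.app_comp]
        exact Y.obj.comp_congr h (hg a).symm (hg b).symm e)
      app_unit := fun {i} a => (hf (i + 1)).1 (by
        rw [hg, f.hom.app_unit, hg]) }
  refine ⟨g, ?_, ?_⟩
  · exact ObjectProperty.hom_ext _ (InfPrecat.Hom.ext (IsIso.hom_inv_id f.hom.app))
  · exact ObjectProperty.hom_ext _ (InfPrecat.Hom.ext (IsIso.inv_hom_id f.hom.app))

/-! ### Globular pasting schemes -/

lemma Table.elem_bijective {T : Table} (a : Globe.{u}) :
    Function.Bijective (fun x : T.globularSet.obj (op a) => Table.elem x) := by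
  refine ⟨fun x y h => ?_, fun f => ⟨yonedaEquiv (legSingle a.dim ≫ f.hom), ?_⟩⟩
  · apply yonedaEquiv.symm.injective
    rw [← legSingle_elem, ← legSingle_elem, show elem x = elem y from h]
  · exact elem_eq (Equiv.symm_apply_apply _ _).symm

/-- The globular set associated to an object of `Θ₀` is the globular sum. -/
noncomputable def Table.globularSetIso (T : Table) :
    T.globularSet ≅ theta0ToGlobularSet.{u}.obj T.obj :=
  NatIso.ofComponents (fun a => (Equiv.ofBijective _ (T.elem_bijective a.unop)).toIso)
    (fun f => by
      ext x
      exact Table.elem_map f.unop x)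

lemma isPastingScheme_iff {P : GlobularSet.{u}} :
    IsPastingScheme P ↔ ∃ T : Table, Nonempty (T.globularSet ≅ P) :=
  ⟨fun ⟨T, ⟨e⟩⟩ => ⟨T, ⟨T.globularSetIso ≪≫ e⟩⟩,
    fun ⟨T, ⟨e⟩⟩ => ⟨T, ⟨T.globularSetIso.symm ≪≫ e⟩⟩⟩

/-! ### Categorical globular extensions with free cells -/

namespace CatStructure

section

variable {C : Type w} [Category.{u} C] (S : CatStructure.{u} C)

/-- The composition of the cells of an object of `C`. -/
lemma toInfCat_comp {X : C} {i j : ℕ} (h : j < i) (a b : disk S.functor i ⟶ X)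
    (e : src S.functor h ≫ a = tgt S.functor h ≫ b) :
    (S.toInfCat.obj X).obj.comp h a b e = S.nabla h ≫ S.copair h a b e := by
  refine congrArg (fun f => S.nabla h ≫ f) (Eq.symm ?_)
  apply PrecatStructure.pairElem_eq (X := yoneda.obj X)
  · exact S.isGlobular.eps₁_copair h a b e
  · exact S.isGlobular.eps₂_copair h a b e

/-- The cells of the globular sums of `C` are freely generated: for each table of dimensions, the
strict `∞`-category of cells of the corresponding globular sum is free on the globular sum of
globular sets. -/
def HasFreeCells : Prop :=
  ∀ T : Table, IsUniversalMap (X := S.toInfCat.obj (S.functor.obj T.obj)) (S.unitMap T)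

variable {S}

lemma toInfCat_map_bijective (hS : S.HasFreeCells) (T : Table) (Y : C) :
    Function.Bijective (S.toInfCat.map : (S.functor.obj T.obj ⟶ Y) → _) := by
  refine ⟨fun f g h => ?_, fun φ => ?_⟩
  · refine (S.existsUnique_unitMap (S.unitMap T ≫ S.cellsMap f)).unique rfl ?_
    exact congrArg (fun φ => S.unitMap T ≫ φ.hom.app) h.symm
  · obtain ⟨f, hf, -⟩ := S.existsUnique_unitMap (S.unitMap T ≫ φ.hom.app)
    exact ⟨f, (hS T).hom_ext hf⟩

lemma toInfCat_faithful (hS : S.HasFreeCells)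
    (hS' : ∀ X : C, ∃ T : Table, Nonempty (S.functor.obj T.obj ≅ X)) : S.toInfCat.Faithful where
  map_injective {X Y} f g h := by
    obtain ⟨T, ⟨e⟩⟩ := hS' X
    rw [← cancel_epi e.hom]
    exact (toInfCat_map_bijective hS T Y).1 (by rw [Functor.map_comp, h, Functor.map_comp])

lemma toInfCat_full (hS : S.HasFreeCells)
    (hS' : ∀ X : C, ∃ T : Table, Nonempty (S.functor.obj T.obj ≅ X)) : S.toInfCat.Full where
  map_surjective {X Y} φ := by
    obtain ⟨T, ⟨e⟩⟩ := hS' X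
    obtain ⟨f, hf⟩ := (toInfCat_map_bijective hS T Y).2 (S.toInfCat.map e.hom ≫ φ)
    refine ⟨e.inv ≫ f, ?_⟩
    rw [Functor.map_comp, hf, ← Category.assoc, ← Functor.map_comp, e.inv_hom_id,
      CategoryTheory.Functor.map_id, Category.id_comp]

lemma toInfCat_essImage_iff (hS : S.HasFreeCells)
    (hS' : ∀ X : C, ∃ T : Table, Nonempty (S.functor.obj T.obj ≅ X)) (X : InfCat.{u}) :
    S.toInfCat.essImage X ↔ ∃ P : GlobularSet.{u}, IsPastingScheme P ∧ IsFreeOn X P := by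
  constructor
  · rintro ⟨Y, ⟨e⟩⟩
    obtain ⟨T, ⟨e'⟩⟩ := hS' Y
    exact ⟨T.globularSet, isPastingScheme_iff.2 ⟨T, ⟨Iso.refl _⟩⟩,
      ((hS T).comp_iso (S.toInfCat.mapIso e' ≪≫ e)).isFreeOn⟩
  · rintro ⟨P, hP, hX⟩
    obtain ⟨T, ⟨e⟩⟩ := isPastingScheme_iff.1 hP
    obtain ⟨η, hη⟩ := isFreeOn_iff.1 hX
    exact ⟨_, (hS T).nonempty_iso (hη.iso_comp e)⟩

end

/-- The image of a categorical globular extension structure by a functor which respects globular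
sums. -/
noncomputable abbrev imageOf {C : Type w} [Category.{u} C] (S : CatStructure.{u} C)
    {E : Type w'} [Category.{u} E] (H : C ⥤ E) (hH : IsGlobularUnder (S.functor ⋙ H)) :
    CatStructure.{u} E where
  toPrecatStructure := S.toPrecatStructure.image H hH
  isCategorical := S.isCategorical.image H hH

section

variable {C : Type w} [Category.{u} C] (S : CatStructure.{u} C)
  {E : Type w'} [Category.{u} E] (H : C ⥤ E) (hH : IsGlobularUnder (S.functor ⋙ H))

/-- A functor which respects globular sums induces morphisms between the strict `∞`-categories of
cells. -/
noncomputable def imageMap (X : C) :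
    S.toInfCat.obj X ⟶ (S.imageOf H hH).toInfCat.obj (H.obj X) :=
  ObjectProperty.homMk
    { app :=
        { app := fun a => ↾fun f => H.map f
          naturality := fun a b f => by
            ext g
            exact H.map_comp _ _ }
      app_comp := fun {i j} h a b e => by
        refine (congrArg H.map (S.toInfCat_comp h a b e)).trans ?_
        refine Eq.trans ?_ ((S.imageOf H hH).toInfCat_comp h (H.map a) (H.map b) _).symm
        exact (H.map_comp _ _).trans
          (congrArg (fun f => H.map (S.nabla h) ≫ f) (S.isGlobular.map_copair H hH h a b e))
      app_unit := fun {i} a => H.map_comp _ _ }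

variable {S H hH}

lemma HasFreeCells.of_image (h : (S.imageOf H hH).HasFreeCells) [H.Full] [H.Faithful] :
    S.HasFreeCells := by
  intro T
  have : IsIso (S.imageMap H hH (S.functor.obj T.obj)) :=
    InfCat.isIso_of_bijective _ fun i => ⟨H.map_injective, H.map_surjective⟩
  exact .of_comp_iso (asIso (S.imageMap H hH (S.functor.obj T.obj))) (h T)

end

end CatStructure

/-! ### The category of free strict `∞`-categories on globular sums -/

/-- The full subcategory of strict `∞`-categories on the free ones on the globular sums, indexed by
the tables of dimensions. -/
abbrev FreeTheta : Type u :=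
  InducedCategory InfCat.{u} (fun T : ULift.{u} Table => free T.down.globularSet)

/-- The free strict `∞`-category underlying an object of `FreeTheta`. -/
noncomputable abbrev FreeTheta.toInf (X : FreeTheta.{u}) : InfCat.{u} :=
  free (ULift.down (α := Table) X).globularSet

namespace Free

lemma lift_η_app {P : GlobularSet.{u}} {X : InfCat.{u}} (φ : P ⟶ X.obj.cells) {a : Globe.{u}ᵒᵖ}
    (x : P.obj a) : (lift φ).hom.app.app a ((η P).app a x) = φ.app a x :=
  congrArg (fun ψ : P ⟶ X.obj.cells => ψ.app a x) (η_lift φ)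

end Free

namespace FreeTheta

open Free

/-- The functor `Θ₀ ⥤ FreeTheta` sending a table of dimensions to the free strict `∞`-category on
its globular sum. -/
noncomputable def functor : Theta0.{u} ⥤ FreeTheta.{u} where
  obj T := ULift.up T
  map f := InducedCategory.homMk (lift (f.hom ≫ η _))
  map_id T := by
    apply InducedCategory.hom_ext
    refine Free.hom_ext ((η_lift _).trans ?_)
    rfl
  map_comp f g := by
    apply InducedCategory.hom_ext
    refine Free.hom_ext ((η_lift _).trans ?_)
    change _ = η _ ≫ (lift (f.hom ≫ η _)).hom.app ≫ (lift (g.hom ≫ η _)).hom.app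
    rw [← Category.assoc, η_lift, Category.assoc, η_lift]
    rfl

lemma functor_map_η {T T' : Table} (f : T.obj ⟶ T'.obj) {a : Globe.{u}ᵒᵖ}
    (x : T.globularSet.obj a) :
    (functor.{u}.map f).hom.hom.app.app a ((η _).app a x) =
      (η T'.globularSet).app a (f.hom.app a x) :=
  lift_η_app _ x

/-- The generator of the free strict `∞`-category on a disk. -/
noncomputable abbrev gen (i : ℕ) : (Table.single i).globularSet.obj (op (D.{u} i)) :=
  yonedaEquiv (Table.legSingle i)

lemma map_gen {a b : Globe.{u}} (f : a ⟶ b) :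
    (globeToTheta0.map f).hom.app _ (gen a.dim) =
      (Table.single b.dim).globularSet.map f.op (gen b.dim) := by
  refine (yonedaEquiv_comp _ _).symm.trans ?_
  exact (congrArg yonedaEquiv (legSingle_globeToTheta0 f)).trans (yonedaEquiv_naturality _ _).symm

lemma incl_gen (T : Table) (k : Fin (T.n + 1)) :
    (T.incl k).hom.app _ (gen.{u} (T.dim k)) = T.top k := by
  refine (yonedaEquiv_comp _ _).symm.trans ?_
  exact congrArg yonedaEquiv (legSingle_incl T k)

variable {X : FreeTheta.{u}}

/-- The cell corresponding to a morphism from a disk. -/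
noncomputable def cell {i : ℕ} (f : disk functor i ⟶ X) : X.toInf.obj.cells.cell i :=
  f.hom.hom.app.app _ ((η (Table.single i).globularSet).app _ (gen i))

/-- The morphism from a disk corresponding to a cell. -/
noncomputable def ofCell {i : ℕ} (c : X.toInf.obj.cells.cell i) : disk functor i ⟶ X :=
  InducedCategory.homMk (lift (Table.descSingle i (yonedaEquiv.symm c)))

@[simp]
lemma cell_ofCell {i : ℕ} (c : X.toInf.obj.cells.cell i) : cell (ofCell c) = c := by
  refine (lift_η_app _ _).trans ?_
  refine (yonedaEquiv_comp _ _).symm.trans ?_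
  exact (congrArg yonedaEquiv (Table.legSingle_descSingle i _)).trans
    (Equiv.apply_symm_apply _ _)

lemma cell_injective {i : ℕ} {f g : disk functor i ⟶ X} (h : cell f = cell g) : f = g := by
  apply InducedCategory.hom_ext
  refine Free.hom_ext (Table.single_hom_ext (yonedaEquiv.injective ?_))
  exact (yonedaEquiv_comp (Table.legSingle i) (η _ ≫ f.hom.hom.app)).trans
    (h.trans (yonedaEquiv_comp (Table.legSingle i) (η _ ≫ g.hom.hom.app)).symm)

lemma cell_comp {i : ℕ} {Y : FreeTheta.{u}} (f : disk functor i ⟶ X) (g : X ⟶ Y) :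
    cell (f ≫ g) = g.hom.hom.app.app _ (cell f) := rfl

lemma cell_map_comp {T : Table} {i : ℕ} (f : globeToTheta0.obj (D i) ⟶ T.obj)
    (g : functor.obj T.obj ⟶ X) :
    cell (functor.map f ≫ g) = g.hom.hom.app.app _ ((η _).app _ (f.hom.app _ (gen i))) :=
  congrArg (g.hom.hom.app.app _) (functor_map_η f (gen i))

lemma cell_map {a b : Globe.{u}} (f : a ⟶ b) (g : disk functor b.dim ⟶ X) :
    cell (functor.map (globeToTheta0.map f) ≫ g) = X.toInf.obj.cells.map f.op (cell g) := by
  refine (cell_map_comp _ g).trans ?_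
  refine (congrArg (fun x => g.hom.hom.app.app (op a) ((η _).app (op a) x)) (map_gen f)).trans ?_
  refine (congrArg (g.hom.hom.app.app (op a)) (NatTrans.naturality_apply (η _) f.op _)).trans ?_
  exact NatTrans.naturality_apply g.hom.hom.app f.op _

lemma cell_src {i j : ℕ} (h : j < i) (f : disk functor i ⟶ X) :
    cell (src functor h ≫ f) = X.toInf.obj.cells.s h (cell f) :=
  cell_map (sigma h) f

lemma cell_tgt {i j : ℕ} (h : j < i) (f : disk functor i ⟶ X) :
    cell (tgt functor h ≫ f) = X.toInf.obj.cells.t h (cell f) :=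
  cell_map (tau h) f

lemma cell_eps (T : Table) (k : Fin (T.n + 1)) (f : functor.obj T.obj ⟶ X) :
    cell (eps functor T k ≫ f) = f.hom.hom.app.app _ ((η _).app _ (T.top k)) := by
  refine (cell_map_comp _ f).trans ?_
  rw [incl_gen]

lemma hom_ext_eps {T : Table} {f g : functor.obj T.obj ⟶ X}
    (h : ∀ k, eps functor T k ≫ f = eps functor T k ≫ g) : f = g := by
  apply InducedCategory.hom_ext
  refine Free.hom_ext (Table.globularSet_hom_ext fun k => ?_)
  exact (cell_eps T k f).symm.trans ((congrArg cell (h k)).trans (cell_eps T k g))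

/-- The morphism from the free strict `∞`-category on a globular sum given by the images of the
principal cells. -/
noncomputable def descEps (T : Table) (x : ∀ k : Fin (T.n + 1), disk functor (T.dim k) ⟶ X)
    (hx : ∀ k : Fin T.n, src functor (T.gap_lt_left k) ≫ x k.castSucc =
      tgt functor (T.gap_lt_right k) ≫ x k.succ) : functor.obj T.obj ⟶ X :=
  InducedCategory.homMk (lift (Table.descCells (fun k => cell (x k)) (fun k => by
    have := congrArg cell (hx k)
    rw [cell_src, cell_tgt] at this
    exact this)))

lemma eps_descEps (T : Table) (x : ∀ k : Fin (T.n + 1), disk functor (T.dim k) ⟶ X)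
    (hx : ∀ k : Fin T.n, src functor (T.gap_lt_left k) ≫ x k.castSucc =
      tgt functor (T.gap_lt_right k) ≫ x k.succ) (k : Fin (T.n + 1)) :
    eps functor T k ≫ descEps T x hx = x k := by
  apply cell_injective
  rw [cell_eps]
  exact (lift_η_app _ _).trans (Table.descCells_top _ _ k)

lemma isGlobularUnder : IsGlobularUnder functor.{u} := by
  have key : ∀ T : Table, Nonempty (IsColimit (sumCofork functor.{u} T)) := fun T =>
    ⟨Multicofork.IsColimit.mk _ (fun E => descEps T (fun k => E.π k) (fun k => E.condition k))
      (fun E k => eps_descEps T _ _ k)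
      (fun E m hm => hom_ext_eps fun k => (hm k).trans (eps_descEps T _ _ k).symm)⟩
  exact ⟨fun T => HasColimit.mk ⟨_, (key T).some⟩, key⟩

/-- The morphism corresponding to the composite of the two principal cells. -/
noncomputable def nabla {i j : ℕ} (h : j < i) : disk functor.{u} i ⟶ pairObj functor h :=
  ofCell ((pairObj functor h).toInf.obj.comp h (cell (eps₁ functor h)) (cell (eps₂ functor h)) (by
    have := congrArg cell (src_eps₁ functor.{u} h)
    rwa [cell_src, cell_tgt] at this))

/-- The morphism corresponding to the unit of the generator. -/
noncomputable def kappa (i : ℕ) : disk functor.{u} (i + 1) ⟶ disk functor i :=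
  ofCell ((disk functor i).toInf.obj.unit (cell (𝟙 (disk functor i))))

lemma cell_compat {i j : ℕ} {h : j < i} {a b : disk functor i ⟶ X}
    (e : src functor h ≫ a = tgt functor h ≫ b) :
    X.toInf.obj.cells.s h (cell a) = X.toInf.obj.cells.t h (cell b) := by
  rw [← cell_src, ← cell_tgt, e]

lemma cell_nabla_comp {i j : ℕ} (h : j < i) (f : pairObj functor h ⟶ X) :
    cell (nabla h ≫ f) = X.toInf.obj.comp h (cell (eps₁ functor h ≫ f)) (cell (eps₂ functor h ≫ f))
      (cell_compat (by rw [← Category.assoc, src_eps₁, Category.assoc])) := by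
  rw [cell_comp, nabla, cell_ofCell]
  exact f.hom.hom.app_comp h _ _ _

lemma cell_nabla {i j : ℕ} (h : j < i) :
    cell (nabla.{u} h) = (pairObj functor h).toInf.obj.comp h (cell (eps₁ functor h))
      (cell (eps₂ functor h)) (cell_compat (src_eps₁ functor h)) :=
  cell_ofCell _

lemma cell_nabla_copair {i j : ℕ} (h : j < i) (a b : disk functor i ⟶ X)
    (e : src functor h ≫ a = tgt functor h ≫ b) :
    cell (nabla h ≫ isGlobularUnder.copair h a b e) =
      X.toInf.obj.comp h (cell a) (cell b) (cell_compat e) := by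
  rw [cell_nabla_comp]
  apply X.toInf.obj.comp_congr
  · rw [IsGlobularUnder.eps₁_copair]
  · rw [IsGlobularUnder.eps₂_copair]

lemma cell_kappa_comp (i : ℕ) (f : disk functor i ⟶ X) :
    cell (kappa i ≫ f) = X.toInf.obj.unit (cell f) := by
  rw [cell_comp, kappa, cell_ofCell]
  refine (f.hom.hom.app_unit _).trans (congrArg _ ?_)
  rw [← cell_comp, Category.id_comp]

/-- The precategorical globular extension structure on `FreeTheta`. -/
noncomputable def precatStructure : PrecatStructure.{u} FreeTheta.{u} where
  functor := functor
  isGlobular := isGlobularUnder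
  nabla := nabla
  kappa := kappa
  src_nabla_top i := by
    apply cell_injective
    rw [cell_src, cell_src, cell_nabla]
    exact InfPrecat.s_comp_top _ _ _ _
  src_nabla_low h := by
    apply cell_injective
    rw [cell_src, cell_nabla, cell_nabla_copair]
    exact (InfPrecat.s_comp_low _ h _ _ _).trans
      (InfPrecat.comp_congr _ h (cell_src _ _).symm (cell_src _ _).symm _)
  tgt_nabla_top i := by
    apply cell_injective
    rw [cell_tgt, cell_tgt, cell_nabla]
    exact InfPrecat.t_comp_top _ _ _ _
  tgt_nabla_low h := by
    apply cell_injective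
    rw [cell_tgt, cell_nabla, cell_nabla_copair]
    exact (InfPrecat.t_comp_low _ h _ _ _).trans
      (InfPrecat.comp_congr _ h (cell_tgt _ _).symm (cell_tgt _ _).symm _)
  src_kappa i := by
    apply cell_injective
    rw [cell_src, kappa, cell_ofCell]
    exact InfPrecat.s_unit _ _
  tgt_kappa i := by
    apply cell_injective
    rw [cell_tgt, kappa, cell_ofCell]
    exact InfPrecat.t_unit _ _

lemma cell_kappaIter_comp {i j : ℕ} (h : j ≤ i) (f : disk functor j ⟶ X) :
    cell (precatStructure.kappaIter h ≫ f) = X.toInf.obj.unitIter h (cell f) := by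
  induction i, h using Nat.le_induction with
  | base =>
    rw [PrecatStructure.kappaIter_self, InfPrecat.unitIter_self]
    exact congrArg cell (Category.id_comp f)
  | succ i h ih =>
    rw [PrecatStructure.kappaIter_succ _ h, InfPrecat.unitIter_succ _ h, ← ih]
    exact (congrArg cell (Category.assoc _ _ _)).trans (cell_kappa_comp i _)

lemma isCategorical : precatStructure.{u}.IsCategorical where
  ass {i j} h := by
    apply cell_injective
    refine (cell_nabla_copair h _ _ _).trans (Eq.trans ?_ (cell_nabla_copair h _ _ _).symm)
    refine (InfPrecat.comp_congr _ h rfl (cell_nabla_copair h _ _ _) _).trans (Eq.trans ?_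
      (InfPrecat.comp_congr _ h (cell_nabla_copair h _ _ _) rfl _).symm)
    exact ((isStrict.ass h _ _ _ _ _)).symm
  exc {i j k} h h' := by
    apply cell_injective
    refine (cell_nabla_copair _ _ _ _).trans (Eq.trans ?_ (cell_nabla_copair _ _ _ _).symm)
    refine (InfPrecat.comp_congr _ _ (cell_nabla_copair _ _ _ _) (cell_nabla_copair _ _ _ _)
      _).trans (Eq.trans ?_ (InfPrecat.comp_congr _ _ (cell_nabla_copair _ _ _ _)
        (cell_nabla_copair _ _ _ _) _).symm)
    exact isStrict.exc h h' _ _ _ _ _ (cell_compat (src_epsQuad₁ functor h h')) _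
  lun h := by
    apply cell_injective
    refine (cell_nabla_copair _ _ _ _).trans ?_
    refine Eq.trans (InfPrecat.comp_congr _ h ?_ rfl _) (isStrict.lun h _)
    refine (cell_kappaIter_comp h.le _).trans (congrArg _ ?_)
    refine (congrArg cell (Category.comp_id _).symm).trans (cell_tgt h _)
  run h := by
    apply cell_injective
    refine (cell_nabla_copair _ _ _ _).trans ?_
    refine Eq.trans (InfPrecat.comp_congr _ h rfl ?_ _) (isStrict.run h _)
    refine (cell_kappaIter_comp h.le _).trans (congrArg _ ?_)
    refine (congrArg cell (Category.comp_id _).symm).trans (cell_src h _)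
  func {i j} h := by
    apply cell_injective
    refine (cell_kappa_comp _ _).trans (Eq.trans ?_ (cell_nabla_copair _ _ _ _).symm)
    refine (congrArg _ (cell_nabla h)).trans ?_
    refine (isStrict.func h _ _ _).trans ?_
    exact InfPrecat.comp_congr _ _ (cell_kappa_comp _ _).symm (cell_kappa_comp _ _).symm _

/-- The categorical globular extension structure on `FreeTheta`. -/
noncomputable def catStructure : CatStructure.{u} FreeTheta.{u} where
  toPrecatStructure := precatStructure
  isCategorical := isCategorical

/-- The canonical morphism from the strict `∞`-category of morphisms from the disks to an object of
`FreeTheta` to this object.  It is bijective on cells. -/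
noncomputable def toInfCatToInf (X : FreeTheta.{u}) : catStructure.toInfCat.obj X ⟶ X.toInf :=
  ObjectProperty.homMk
    { app :=
        { app := fun a => ↾fun f => cell (i := a.unop.dim) f
          naturality := fun a b f => by
            ext g
            exact cell_map f.unop g }
      app_comp := fun {i j} h a b e =>
        (congrArg cell (catStructure.toInfCat_comp h a b e)).trans (cell_nabla_copair h a b e)
      app_unit := fun {i} a => cell_kappa_comp i a }

lemma hasFreeCells : catStructure.{u}.HasFreeCells := by
  intro T
  have : IsIso (toInfCatToInf.{u} (functor.obj T.obj)) :=
    InfCat.isIso_of_bijective _ fun i =>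
      ⟨fun f g h => cell_injective h, fun c => ⟨ofCell c, cell_ofCell c⟩⟩
  refine .of_comp_iso (@asIso _ _ _ _ (toInfCatToInf.{u} (functor.obj T.obj)) this) ?_
  have h : catStructure.unitMap T ≫ (toInfCatToInf.{u} (functor.obj T.obj)).hom.app =
      η T.globularSet := by
    refine Table.globularSet_hom_ext fun k => ?_
    refine (congrArg cell (catStructure.unitMap_top T k)).trans ?_
    refine (congrArg cell (Category.comp_id _).symm).trans ?_
    exact cell_eps T k _
  change IsUniversalMap (catStructure.unitMap T ≫ (toInfCatToInf.{u} (functor.obj T.obj)).hom.app)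
  rw [h]
  exact Free.isUniversalMap _

end FreeTheta

/-! ### The universal property of the category of free strict `∞`-categories -/

/-- Equality of structures whose functors are only propositionally equal, the operations being
compared up to transport. -/
lemma CatStructure.ext_of_functor {C : Type w} [Category.{v} C] {S S' : CatStructure.{u} C}
    (h : S.functor = S'.functor)
    (hn : ∀ {i j : ℕ} (hij : j < i),
      S.nabla hij ≫ eqToHom (congrArg (fun F : Theta0.{u} ⥤ C => F.obj (Table.pair hij).obj) h) =
        eqToHom (congrArg (fun F : Theta0.{u} ⥤ C => F.obj (globeToTheta0.obj (D i))) h) ≫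
          S'.nabla hij)
    (hk : ∀ i : ℕ,
      S.kappa i ≫ eqToHom (congrArg (fun F : Theta0.{u} ⥤ C => F.obj (globeToTheta0.obj (D i))) h) =
        eqToHom (congrArg (fun F : Theta0.{u} ⥤ C => F.obj (globeToTheta0.obj (D (i + 1)))) h) ≫
          S'.kappa i) : S = S' := by
  obtain ⟨⟨F, hF, n, k, _, _, _, _, _, _⟩, _⟩ := S
  obtain ⟨⟨F', hF', n', k', _, _, _, _, _, _⟩, _⟩ := S'
  obtain rfl : F = F' := h
  obtain rfl : @n = @n' := by
    funext i j hij
    simpa using hn hij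
  obtain rfl : k = k' := by
    funext i
    simpa using hk i
  rfl

lemma CatStructure.eqToHom_app {C : Type w} [Category.{v} C] {S S' : CatStructure.{u} C}
    (h : S = S') (T : Theta0.{u}) :
    (CatStructure.Hom.app (eqToHom h)).app T = eqToHom (by rw [h]) := by
  subst h
  rfl

namespace FreeTheta

open Free

section

variable {C : Type w} [Category.{u} C] (S : CatStructure.{u} C)

/-- The evaluation of the cells of a free strict `∞`-category on a globular sum in a categorical
globular extension. -/
noncomputable def ev (T : Table) :
    free T.globularSet ⟶ S.toInfCat.obj (S.functor.obj T.obj) :=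
  lift (S.unitMap T)

lemma η_ev (T : Table) : η _ ≫ (ev S T).hom.app = S.unitMap T :=
  η_lift (X := S.toInfCat.obj (S.functor.obj T.obj)) (S.unitMap T)

/-- Morphisms from a globular sum of `C` are the morphisms from the free strict `∞`-category on the
corresponding globular sum of globular sets. -/
lemma existsUnique_ev {T : Table} {X : C} (φ : free T.globularSet ⟶ S.toInfCat.obj X) :
    ∃! f : S.functor.obj T.obj ⟶ X, ev S T ≫ S.toInfCat.map f = φ := by
  have key : ∀ f : S.functor.obj T.obj ⟶ X, ev S T ≫ S.toInfCat.map f = φ ↔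
      S.unitMap T ≫ S.cellsMap f = η _ ≫ φ.hom.app := by
    intro f
    have h : η _ ≫ (ev S T ≫ S.toInfCat.map f).hom.app = S.unitMap T ≫ S.cellsMap f :=
      (Category.assoc _ _ _).symm.trans
        (congrArg (· ≫ S.cellsMap f) (η_ev S T))
    exact ⟨fun e => by rw [← h, e], fun e => Free.hom_ext (h.trans e)⟩
  obtain ⟨f, hf, hf'⟩ := S.existsUnique_unitMap (η _ ≫ φ.hom.app)
  exact ⟨f, (key f).2 hf, fun g hg => hf' g ((key g).1 hg)⟩

/-- The functor from `FreeTheta` to a categorical globular extension: the image of a morphism of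
free strict `∞`-categories is the unique morphism compatible with the evaluations. -/
noncomputable def extend : FreeTheta.{u} ⥤ C where
  obj X := S.functor.obj X.down
  map {X Y} f := (existsUnique_ev S (f.hom ≫ ev S Y.down)).choose
  map_id X := (existsUnique_ev S _).unique (existsUnique_ev S _).choose_spec.1 (by
    rw [CategoryTheory.Functor.map_id]; rfl)
  map_comp {X Y Z} f g := (existsUnique_ev S _).unique (existsUnique_ev S _).choose_spec.1 (by
    rw [Functor.map_comp, ← Category.assoc,
      (existsUnique_ev S (f.hom ≫ ev S Y.down)).choose_spec.1, Category.assoc,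
      (existsUnique_ev S (g.hom ≫ ev S Z.down)).choose_spec.1]
    rfl)

lemma extend_map_eq {X Y : FreeTheta.{u}} {f : X ⟶ Y}
    {g : S.functor.obj X.down ⟶ S.functor.obj Y.down}
    (h : ev S X.down ≫ S.toInfCat.map g = f.hom ≫ ev S Y.down) : (extend S).map f = g :=
  (existsUnique_ev S _).unique (existsUnique_ev S _).choose_spec.1 h

lemma functor_extend : functor ⋙ extend S = S.functor :=
  CategoryTheory.Functor.ext (fun _ => rfl) (fun T T' f => by
    refine Eq.trans ?_ ((Category.id_comp _).trans (Category.comp_id _)).symm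
    refine extend_map_eq S (Free.hom_ext ?_)
    have h₁ := congrArg (· ≫ S.cellsMap (S.functor.map f)) (η_ev S T)
    have h₂ := congrArg (· ≫ (ev S T').hom.app) (η_lift (f.hom ≫ η T'.globularSet))
    have h₃ := congrArg (f.hom ≫ ·) (η_ev S T')
    refine (Category.assoc _ _ _).symm.trans (h₁.trans ?_)
    refine (S.unitMap_naturality f).symm.trans (h₃.symm.trans ?_)
    exact (Category.assoc _ _ _).symm.trans (h₂.symm.trans (Category.assoc _ _ _)))

lemma isGlobularUnder_extend : IsGlobularUnder (functor ⋙ extend S) := by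
  rw [functor_extend]
  exact S.isGlobular

lemma ev_cell_eps (T : Table) (k : Fin (T.n + 1)) :
    (ev S T).hom.app.app _ (cell (eps functor.{u} T k)) = eps S.functor T k := by
  have h : cell (eps functor.{u} T k) = (η _).app _ (T.top k) :=
    (congrArg cell (Category.comp_id _).symm).trans (cell_eps T k (𝟙 _))
  refine (congrArg ((ev S T).hom.app.app _) h).trans ?_
  exact (lift_η_app _ _).trans (S.unitMap_top T k)

lemma elem_gen (i : ℕ) : Table.elem (gen.{u} i) = 𝟙 _ :=
  Table.elem_eq ((Category.comp_id _).trans (Equiv.symm_apply_apply _ _).symm)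

lemma ev_gen (i : ℕ) :
    (ev S (Table.single i)).hom.app.app (op (D i)) ((η _).app _ (gen i)) = 𝟙 (disk S.functor i) :=
  (lift_η_app _ _).trans ((congrArg S.functor.map (elem_gen i)).trans (S.functor.map_id _))

lemma extend_map_eq_of_cell {i : ℕ} {Y : FreeTheta.{u}} {f : disk functor i ⟶ Y}
    {g : disk S.functor i ⟶ S.functor.obj Y.down}
    (h : (ev S Y.down).hom.app.app _ (cell f) = g) : (extend S).map f = g := by
  refine extend_map_eq S (Free.hom_ext (Table.single_hom_ext (yonedaEquiv.injective ?_)))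
  refine (yonedaEquiv_comp (Table.legSingle i) (η _ ≫ (ev S (Table.single i) ≫
    S.toInfCat.map g).hom.app)).trans (Eq.trans ?_ (yonedaEquiv_comp (Table.legSingle i)
      (η _ ≫ (f.hom ≫ ev S Y.down).hom.app)).symm)
  refine Eq.trans ?_ h.symm
  exact (congrArg (fun a => a ≫ g) (ev_gen S i)).trans (Category.id_comp g)

lemma extend_nabla {i j : ℕ} (h : j < i) : (extend S).map (nabla h) = S.nabla h := by
  apply extend_map_eq_of_cell
  refine (congrArg ((ev S (Table.pair h)).hom.app.app _) (cell_nabla h)).trans ?_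
  refine ((ev S (Table.pair h)).hom.app_comp h _ _ _).trans ?_
  refine (InfPrecat.comp_congr _ h (ev_cell_eps S (Table.pair h) (0 : Fin 2))
    (ev_cell_eps S (Table.pair h) (1 : Fin 2)) _).trans ?_
  refine (S.toInfCat_comp h (eps₁ S.functor h) (eps₂ S.functor h) (src_eps₁ S.functor h)).trans ?_
  refine (congrArg (fun f => S.nabla h ≫ f) (S.isGlobular.pair_ext h ?_ ?_)).trans
    (Category.comp_id _)
  · exact (S.isGlobular.eps₁_copair h _ _ _).trans (Category.comp_id _).symm
  · exact (S.isGlobular.eps₂_copair h _ _ _).trans (Category.comp_id _).symm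

lemma extend_kappa (i : ℕ) : (extend S).map (kappa i) = S.kappa i := by
  apply extend_map_eq_of_cell
  refine (congrArg ((ev S (Table.single i)).hom.app.app _) (cell_ofCell _)).trans ?_
  refine ((ev S (Table.single i)).hom.app_unit _).trans ?_
  exact (congrArg (fun f => S.kappa i ≫ f) (ev_gen S i)).trans (Category.comp_id _)

lemma restrict_extend :
    (catStructure.restrict C).obj ⟨extend S, isGlobularUnder_extend S⟩ = S :=
  CatStructure.ext_of_functor (functor_extend S)
    (fun h => (Category.comp_id _).trans ((extend_nabla S h).trans (Category.id_comp _).symm))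
    (fun i => (Category.comp_id _).trans ((extend_kappa S i).trans (Category.id_comp _).symm))

end

section

lemma ofCell_η {T : Table} {i : ℕ} (x : GlobularSet.cell.{u} T.globularSet i) :
    ofCell (X := functor.obj T.obj) ((η T.globularSet).app _ x) = functor.map (Table.elem x) := by
  apply cell_injective
  refine (cell_ofCell _).trans ?_
  refine Eq.symm ((functor_map_η (Table.elem x) (gen i)).trans (congrArg ((η _).app _) ?_))
  refine (yonedaEquiv_comp _ _).symm.trans ?_
  exact (congrArg yonedaEquiv (Table.legSingle_elem x)).trans (Equiv.apply_symm_apply _ _)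

lemma ofCell_compat {X : FreeTheta.{u}} {i j : ℕ} {h : j < i} {a b : X.toInf.obj.cells.cell i}
    (e : X.toInf.obj.cells.s h a = X.toInf.obj.cells.t h b) :
    src functor h ≫ ofCell a = tgt functor h ≫ ofCell b := by
  apply cell_injective
  rw [cell_src, cell_tgt, cell_ofCell, cell_ofCell, e]

lemma ofCell_comp {X : FreeTheta.{u}} {i j : ℕ} (h : j < i) (a b : X.toInf.obj.cells.cell i)
    (e : X.toInf.obj.cells.s h a = X.toInf.obj.cells.t h b) :
    ofCell (X.toInf.obj.comp h a b e) =
      nabla h ≫ isGlobularUnder.copair h (ofCell a) (ofCell b) (ofCell_compat e) := by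
  apply cell_injective
  rw [cell_ofCell, cell_nabla_copair]
  exact X.toInf.obj.comp_congr h (cell_ofCell a).symm (cell_ofCell b).symm e

lemma ofCell_unit {X : FreeTheta.{u}} {i : ℕ} (a : X.toInf.obj.cells.cell i) :
    ofCell (X.toInf.obj.unit a) = kappa i ≫ ofCell a := by
  apply cell_injective
  rw [cell_ofCell, cell_kappa_comp, cell_ofCell]

section

variable {B : Type w} [Category.{v} B] {C : Type w'} [Category.{v} C] {H H' : B ⥤ C} {X Y Z : B}
  {f : X ⟶ Y} {g : Y ⟶ Z} {a : H.obj X ⟶ H'.obj X} {b : H.obj Y ⟶ H'.obj Y}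
  {c : H.obj Z ⟶ H'.obj Z}

/-- Pasting of naturality squares. -/
lemma square_comp (h : H.map f ≫ b = a ≫ H'.map f) (h' : H.map g ≫ c = b ≫ H'.map g) :
    H.map (f ≫ g) ≫ c = a ≫ H'.map (f ≫ g) := by
  rw [H.map_comp, H'.map_comp, Category.assoc, h', reassoc_of% h]

lemma square_cancel (h : H.map f ≫ b = a ≫ H'.map f)
    (h' : H.map (f ≫ g) ≫ c = a ≫ H'.map (f ≫ g)) :
    H.map f ≫ H.map g ≫ c = H.map f ≫ b ≫ H'.map g := by
  rw [reassoc_of% h, ← H'.map_comp, ← h', H.map_comp, Category.assoc]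

end

variable {C : Type w} [Category.{u} C] {H H' : FreeTheta.{u} ⥤ C}
  (α : functor ⋙ H ⟶ functor ⋙ H')

/-- A natural transformation between the restrictions to `Θ₀` of two functors on `FreeTheta`, which
is compatible with `nabla` and `kappa`, is natural with respect to all the cells of the objects of
`FreeTheta`. -/
lemma naturality_ofCell (hH : IsGlobularUnder (functor ⋙ H))
    (hn : ∀ {i j : ℕ} (h : j < i), H.map (nabla h) ≫ α.app (Table.pair h).obj =
      α.app (globeToTheta0.obj (D i)) ≫ H'.map (nabla h))
    (hk : ∀ i : ℕ, H.map (kappa i) ≫ α.app (globeToTheta0.obj (D i)) =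
      α.app (globeToTheta0.obj (D (i + 1))) ≫ H'.map (kappa i))
    {T : Table} {i : ℕ} (c : (free T.globularSet).obj.cells.cell i) :
    H.map (ofCell (X := functor.obj T.obj) c) ≫ α.app T.obj =
      α.app (globeToTheta0.obj (D i)) ≫ H'.map (ofCell (X := functor.obj T.obj) c) := by
  induction c using Free.induction with
  | var x =>
    rw [ofCell_η]
    exact α.naturality (Table.elem x)
  | @comp i j h a b e ha hb =>
    have E := ofCell_compat (X := functor.obj T.obj) e
    have key : H.map (isGlobularUnder.copair h _ _ E) ≫ α.app T.obj =
        α.app (Table.pair h).obj ≫ H'.map (isGlobularUnder.copair h _ _ E) := by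
      apply hH.pair_ext h
      · refine square_cancel (H := H) (H' := H') (f := eps₁ functor h)
          (α.naturality ((Table.pair h).incl (0 : Fin 2))) ?_
        exact (isGlobularUnder.eps₁_copair h _ _ E).symm ▸ ha
      · refine square_cancel (H := H) (H' := H') (f := eps₂ functor h)
          (α.naturality ((Table.pair h).incl (1 : Fin 2))) ?_
        exact (isGlobularUnder.eps₂_copair h _ _ E).symm ▸ hb
    exact (ofCell_comp (X := functor.obj T.obj) h a b e).symm ▸ square_comp (hn h) key
  | @unit i a ha =>
    exact (ofCell_unit (X := functor.obj T.obj) a).symm ▸ square_comp (hk i) ha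

/-- Naturality for all morphisms of `FreeTheta` follows from naturality for cells, since globular
sums are colimits of disks. -/
lemma naturality (hH : IsGlobularUnder (functor ⋙ H))
    (hn : ∀ {i j : ℕ} (h : j < i), H.map (nabla h) ≫ α.app (Table.pair h).obj =
      α.app (globeToTheta0.obj (D i)) ≫ H'.map (nabla h))
    (hk : ∀ i : ℕ, H.map (kappa i) ≫ α.app (globeToTheta0.obj (D i)) =
      α.app (globeToTheta0.obj (D (i + 1))) ≫ H'.map (kappa i))
    {T T' : Table} (f : functor.obj T.obj ⟶ functor.obj T'.obj) :
    H.map f ≫ α.app T'.obj = α.app T.obj ≫ H'.map f := by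
  refine hH.hom_ext T fun k => ?_
  have h₁ : eps functor T k ≫ f = ofCell (cell (eps functor T k ≫ f)) :=
    cell_injective (cell_ofCell _).symm
  have h₂ := naturality_ofCell α hH hn hk (cell (eps functor T k ≫ f))
  exact square_cancel (H := H) (H' := H') (f := eps functor T k) (α.naturality (T.incl k))
    (h₁.symm ▸ h₂)

end

variable (C : Type w) [Category.{u} C]

instance : (catStructure.{u}.restrict C).Faithful where
  map_injective {H H'} α β h := by
    refine ObjectProperty.hom_ext _ (NatTrans.ext (funext fun X => ?_))
    exact congrArg (fun γ => (CatStructure.Hom.app γ).app X.down) h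

instance : (catStructure.{u}.restrict C).Full where
  map_surjective {H _} α :=
    ⟨ObjectProperty.homMk
      { app := fun X => (CatStructure.Hom.app α).app X.down
        naturality := fun X Y f =>
          naturality (CatStructure.Hom.app α) H.property (CatStructure.Hom.nabla_app α)
            (CatStructure.Hom.kappa_app α) (T := X.down) (T' := Y.down) f }, rfl⟩

lemma restrict_obj_injective : Function.Injective (catStructure.{u}.restrict C).obj := by
  intro H H' h
  -- By fullness, `eqToHom h` lifts to a natural transformation, whose components are transports
  -- along equalities of objects: its naturality says that the functors agree on morphisms.
  obtain ⟨α, hα⟩ := (catStructure.restrict C).map_surjective (eqToHom h)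
  have hobj : ∀ X : FreeTheta.{u}, H.obj.obj X = H'.obj.obj X :=
    fun X => congrArg (fun S => S.functor.obj X.down) h
  have happ : ∀ X : FreeTheta.{u}, α.hom.app X = eqToHom (hobj X) := fun X =>
    (congrArg (fun γ => (CatStructure.Hom.app γ).app X.down) hα).trans
      (CatStructure.eqToHom_app h X.down)
  have : H.obj = H'.obj := CategoryTheory.Functor.ext hobj (fun X Y f => by
    have h₁ := α.hom.naturality f
    rw [happ, happ] at h₁
    rw [← Category.assoc, ← h₁, Category.assoc, eqToHom_trans, eqToHom_refl, Category.comp_id])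
  exact ObjectProperty.FullSubcategory.ext this

lemma restrict_isIso : (catStructure.{u}.restrict C).IsIso where
  bijective_obj := ⟨restrict_obj_injective C, fun S => ⟨_, restrict_extend S⟩⟩

end FreeTheta

lemma FreeTheta.isUniversal : FreeTheta.catStructure.{u}.IsUniversal :=
  fun C _ => FreeTheta.restrict_isIso C

/-! ### Uniqueness of the universal categorical globular extension -/

section

attribute [local instance] uliftCategory

lemma IsGlobularUnder.comp_upFunctor {C : Type w} [Category.{v} C] {G : Theta0.{u} ⥤ C}
    (hG : IsGlobularUnder G) : IsGlobularUnder (G ⋙ ULift.upFunctor.{v, w, w'}) := by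
  have key : ∀ T : Table, Nonempty (IsColimit (sumCofork (G ⋙ ULift.upFunctor.{v, w, w'}) T)) :=
    fun T => ⟨Multicofork.IsColimit.mk _
      (fun E => hG.desc T (X := E.pt.down) (fun k => E.π k) (fun k => E.condition k))
      (fun E k => hG.eps_desc T (X := E.pt.down) _ _ k)
      (fun E m hm => hG.hom_ext T (X := E.pt.down) fun k =>
        (hm k).trans (hG.eps_desc T (X := E.pt.down) _ _ k).symm)⟩
  exact ⟨fun T => HasColimit.mk ⟨_, (key T).some⟩, key⟩

namespace CatStructure

/-- Transporting a structure along a composite is transporting it twice; the structure obtained on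
the way may be replaced by an equal one. -/
lemma imageOf_comp {A : Type v} {B : Type w} {C : Type w'} [Category.{u} A] [Category.{u} B]
    [Category.{u} C] {S : CatStructure.{u} A} {S' : CatStructure.{u} B} {K : A ⥤ B} {H : B ⥤ C}
    {hK : IsGlobularUnder (S.functor ⋙ K)} (e : S.imageOf K hK = S')
    (hH : IsGlobularUnder (S'.functor ⋙ H)) :
    ∃ hKH : IsGlobularUnder (S.functor ⋙ K ⋙ H), S.imageOf (K ⋙ H) hKH = S'.imageOf H hH := by
  subst e
  exact ⟨hH, rfl⟩

/-- A universal categorical globular extension is equivalent to `FreeTheta`, compatibly with the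
structures. -/
lemma IsUniversal.exists_equivalence {Θ : Type u} [Category.{u} Θ] {S : CatStructure.{u} Θ}
    (hS : S.IsUniversal) :
    ∃ (E : Θ ⥤ FreeTheta.{u}) (hE : IsGlobularUnder (S.functor ⋙ E)),
      E.IsEquivalence ∧ S.imageOf E hE = FreeTheta.catStructure ∧
        E ⋙ FreeTheta.extend S = 𝟭 Θ := by
  let S₁ := FreeTheta.catStructure.{u}
  let K := FreeTheta.extend S
  have eK : S₁.imageOf K (FreeTheta.isGlobularUnder_extend S) = S := FreeTheta.restrict_extend S
  let up₁ : FreeTheta.{u} ⥤ ULift.{u + 1} FreeTheta.{u} := ULift.upFunctor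
  let down₁ : ULift.{u + 1} FreeTheta.{u} ⥤ FreeTheta.{u} := ULift.downFunctor
  let up : Θ ⥤ ULift.{u + 1} Θ := ULift.upFunctor
  have h₁ : IsGlobularUnder (S₁.functor ⋙ up₁) := S₁.isGlobular.comp_upFunctor
  have h₂ : IsGlobularUnder (S.functor ⋙ up) := S.isGlobular.comp_upFunctor
  -- The universal property only tests large categories, hence the lift of `FreeTheta`.
  obtain ⟨⟨H, hH⟩, eH⟩ := (hS (ULift.{u + 1} FreeTheta.{u})).bijective_obj.2 (S₁.imageOf up₁ h₁)
  replace eH : S.imageOf H hH = S₁.imageOf up₁ h₁ := eH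
  obtain ⟨hE, eE⟩ := imageOf_comp eH (H := down₁) S₁.isGlobular
  -- Both composites transport the structures to themselves, so they are identities by uniqueness.
  have hKH : K ⋙ H = up₁ := by
    obtain ⟨h, e⟩ := imageOf_comp eK hH
    exact congrArg (fun X => X.obj) (FreeTheta.restrict_obj_injective _
      (a₁ := ⟨K ⋙ H, h⟩) (a₂ := ⟨up₁, h₁⟩) (e.trans eH))
  have hHK : (H ⋙ down₁ ⋙ K) ⋙ up = up := by
    obtain ⟨h, e⟩ := imageOf_comp eK h₂
    obtain ⟨h', e'⟩ := imageOf_comp eH (H := down₁ ⋙ K ⋙ up) h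
    exact congrArg (fun X => X.obj) ((hS (ULift.{u + 1} Θ)).bijective_obj.1
      (a₁ := ⟨H ⋙ down₁ ⋙ K ⋙ up, h'⟩) (a₂ := ⟨up, h₂⟩) (e'.trans e))
  have e₁ : (H ⋙ down₁) ⋙ K = 𝟭 Θ := congrArg (· ⋙ ULift.downFunctor) hHK
  have e₂ : K ⋙ H ⋙ down₁ = 𝟭 FreeTheta.{u} := congrArg (· ⋙ down₁) hKH
  exact ⟨H ⋙ down₁, hE,
    (CategoryTheory.Equivalence.mk (H ⋙ down₁) K (eqToIso e₁.symm)
      (eqToIso e₂)).isEquivalence_functor,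
    eE, e₁⟩

lemma IsUniversal.hasFreeCells {Θ : Type u} [Category.{u} Θ] {S : CatStructure.{u} Θ}
    (hS : S.IsUniversal) : S.HasFreeCells := by
  obtain ⟨E, hE, hE', e, -⟩ := hS.exists_equivalence
  exact .of_image (H := E) (hH := hE) (e ▸ FreeTheta.hasFreeCells)

/-- Every object of a universal categorical globular extension is a globular sum. -/
lemma IsUniversal.exists_iso {Θ : Type u} [Category.{u} Θ] {S : CatStructure.{u} Θ}
    (hS : S.IsUniversal) (X : Θ) : ∃ T : Table, Nonempty (S.functor.obj T.obj ≅ X) := by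
  obtain ⟨E, -, -, -, e⟩ := hS.exists_equivalence
  exact ⟨(E.obj X).down, ⟨eqToIso (congrArg (fun F => F.obj X) e)⟩⟩

end CatStructure

end

end Globular

theorem mainTheorem8 :
    (∃ (Θ : Type u) (_ : Category.{u} Θ) (S : CatStructure.{u} Θ), S.IsUniversal) ∧
    ∀ (Θ : Type u) [Category.{u} Θ] (S : CatStructure.{u} Θ), S.IsUniversal →
      S.toInfCat.Full ∧ S.toInfCat.Faithful ∧
      (∀ X : InfCat.{u}, S.toInfCat.essImage X ↔
        ∃ P : GlobularSet.{u}, IsPastingScheme P ∧ IsFreeOn X P) ∧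
      ∀ P : GlobularSet.{u}, IsPastingScheme P → ∃ X : InfCat.{u}, IsFreeOn X P :=
  ⟨⟨FreeTheta, inferInstance, FreeTheta.catStructure, FreeTheta.isUniversal⟩,
    fun _ _ _ hS =>
      ⟨CatStructure.toInfCat_full hS.hasFreeCells hS.exists_iso,
        CatStructure.toInfCat_faithful hS.hasFreeCells hS.exists_iso,
        CatStructure.toInfCat_essImage_iff hS.hasFreeCells hS.exists_iso,
        fun P _ => ⟨free P, (Free.isUniversalMap P).isFreeOn⟩⟩⟩
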